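/- **Computational model.** All algorithms are deterministic programs for the random access machine with unit-cost instructions (loading a constant, $+$, $-$, $\cdot$, integer division, indirect load and store, jumps). A problem with instances of size $N$ is *solvable in time $O(T)$* if there is one program such that for every $d$ there are constants $c, C$ with the following property: on every instance $I$ of size $N$ all of whose numbers are at most $(N+2)^d$ in absolute value, the program stops with the correct answer after at most $C\cdot(T(I)+1)$ instructions, and all integers it writes to registers are at most $(N+2)^c$ in absolute value (so words have $O(\log N)$ bits). **Min-Weight $k$-Clique Conjecture.** For no integer $k\ge 3$ and no real $\varepsilon>0$ can the following problem be solved in time $O(n^{k-\varepsilon})$: given an undirected graph with $n$ nodes (size $N=n$) and integer edge weights, as a weighted adjacency matrix, compute the minimum total edge weight of a $k$-clique, or report that there is no $k$-clique. **Star query.** Let $\mathsf{Trop}^+=(\mathbb R_+\cup\{\infty\},\min,+,\infty,0)$ be the tropical semiring. A database $D$ for the star query $Q^\star_\ell$ consists of $\ell$ finite binary relations $R_1,\dots,R_\ell$ over $\mathbb N$, each of whose tuples carries a non-negative integer annotation, regarded as an element of $\mathsf{Trop}^+$; tuples not in $R_i$ have annotation $R_i(x,y)=\infty$. The size $N=|D|$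 is the total number of tuples, and $D$ is given as a list of its annotated tuples. The result is the annotated relation $$Q^\star_\ell(D)(x_1,\dots,x_\ell)=\min_{y}\ \sum_{i=1}^{\ell} R_i(x_i,y),$$ and $\mathrm{OUT}$ is the set of tuples $(x_1,\dots,x_\ell)$ for which this value is not $\infty$. To evaluate the query is to list every tuple of $\mathrm{OUT}$ exactly once, with its annotation. **Theorem.** Assume the Min-Weight $k$-Clique Conjecture. Let $\ell\ge 2$ be an integer and let $\varepsilon>0$ be real. Then the star query $Q^\star_\ell$ over the tropical semiring cannot be evaluated in time $$O\bigl(|D|\cdot|\mathrm{OUT}|^{1-1/\ell-\varepsilon}\bigr),$$ and it cannot even be evaluated in time $$O\bigl(|D|+|\mathrm{OUT}|+|D|\cdot|\mathrm{OUT}|^{1-1/\ell-\varepsilon}\bigr).$$ -/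

import Mathlib

open scoped ENNReal

namespace StarTropical

/-! ## The random access machine (uniform cost, bounded word length) -/

/-- Instructions of the random access machine. `r`, `a`, `b` are names of registers, `t` is a
position in the program. -/
inductive Instr where
  /-- `R[r] := c` -/
  | const (r : ℕ) (c : ℤ)
  /-- `R[r] := R[a] + R[b]` -/
  | add (r a b : ℕ)
  /-- `R[r] := R[a] - R[b]` -/
  | sub (r a b : ℕ)
  /-- `R[r] := R[a] * R[b]` -/
  | mul (r a b : ℕ)
  /-- `R[r] := R[a] / R[b]` (integer division; it fails if `R[b] = 0`) -/
  | div (r a b : ℕ)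
  /-- `R[r] := M[R[a]]` (it fails if `R[a] < 0`) -/
  | load (r a : ℕ)
  /-- `M[R[a]] := R[r]` (it fails if `R[a] < 0`) -/
  | store (a r : ℕ)
  /-- continue at position `t` -/
  | jump (t : ℕ)
  /-- continue at position `t` if `R[r] > 0`, and at the next position otherwise -/
  | jpos (r t : ℕ)

/-- A program is a finite list of instructions. -/
abbrev Program := List Instr

/-- A configuration: program counter, registers, and random access memory. -/
structure State where
  pc : ℕ
  reg : ℕ → ℤ
  mem : ℕ → ℤ

/-- Write `v` to register `r` and advance; this fails if `v` does not fit into a word, that is,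
if `|v| > W`. -/
def State.setReg (W : ℕ) (s : State) (r : ℕ) (v : ℤ) : Option State :=
  if |v| ≤ (W : ℤ) then some ⟨s.pc + 1, Function.update s.reg r v, s.mem⟩ else none

/-- The effect of one instruction on a machine whose words hold the integers of absolute value at
most `W`. -/
def Instr.exec (W : ℕ) (s : State) : Instr → Option State
  | .const r c => s.setReg W r c
  | .add r a b => s.setReg W r (s.reg a + s.reg b)
  | .sub r a b => s.setReg W r (s.reg a - s.reg b)
  | .mul r a b => s.setReg W r (s.reg a * s.reg b)
  | .div r a b => if s.reg b = 0 then none else s.setReg W r (s.reg a / s.reg b)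
  | .load r a => if 0 ≤ s.reg a then s.setReg W r (s.mem (s.reg a).toNat) else none
  | .store a r =>
      if 0 ≤ s.reg a then
        some ⟨s.pc + 1, s.reg, Function.update s.mem (s.reg a).toNat (s.reg r)⟩
      else none
  | .jump t => some ⟨t, s.reg, s.mem⟩
  | .jpos r t => some ⟨if 0 < s.reg r then t else s.pc + 1, s.reg, s.mem⟩

/-- `HaltsIn P W t s s'`: started in `s`, the program `P` executes exactly `t` instructions, none
of which fails, and stops in `s'`. The machine stops when the program counter leaves the
program. -/
def HaltsIn (P : Program) (W : ℕ) : ℕ → State → State → Prop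
  | 0, s, s' => P.length ≤ s.pc ∧ s' = s
  | t + 1, s, s' => ∃ i s₁, P[s.pc]? = some i ∧ i.exec W s = some s₁ ∧ HaltsIn P W t s₁ s'

/-- The initial configuration with memory content `m`: all registers are `0`. -/
def initState (m : ℕ → ℤ) : State := ⟨0, fun _ => 0, m⟩

/-- A computational problem for the random access machine. -/
structure Problem where
  /-- the instances -/
  Inst : Type
  /-- the size of an instance -/
  size : Inst → ℕ
  /-- all numbers that occur in the instance are at most `M` in absolute value -/
  numbersLE : Inst → ℕ → Prop
  /-- the initial content of the memory -/
  input : Inst → ℕ → ℤ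
  /-- the final configuration holds the correct answer for the instance -/
  correct : Inst → State → Prop

/-- The problem can be solved in time `O(T)`: there is one program that, on all instances of size
`N` with polynomially bounded numbers (at most `(N + 2) ^ d`, for any fixed `d`), uses words of
`O(log N)` bits only (integers of absolute value at most `(N + 2) ^ c`), stops with the correct
answer, and executes `O(T)` instructions. -/
def Problem.SolvableInTime (p : Problem) (T : p.Inst → ℝ) : Prop :=
  ∃ P : Program, ∀ d : ℕ, ∃ c C : ℕ, ∀ I : p.Inst, p.numbersLE I ((p.size I + 2) ^ d) →
    ∃ (t : ℕ) (s : State),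
      HaltsIn P ((p.size I + 2) ^ c) t (initState (p.input I)) s ∧
      p.correct I s ∧ (t : ℝ) ≤ C * (T I + 1)

/-! ## Minimum-weight `k`-clique -/

/-- An undirected graph on the nodes `0, …, n - 1` with integer edge weights. -/
structure WGraph where
  n : ℕ
  graph : SimpleGraph (Fin n)
  weight : Sym2 (Fin n) → ℤ

/-- The total weight of all edges inside a set of nodes (of a clique, in the sequel). -/
def WGraph.cliqueWeight (G : WGraph) (s : Finset (Fin G.n)) : ℤ :=
  ∑ u ∈ s, ∑ v ∈ s with u < v, G.weight s(u, v)

open Classical in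
/-- The weighted adjacency matrix in memory: cell `0` holds `n`; for `u, v < n`, cell
`1 + 2 * (u * n + v)` holds `1` or `0` according to whether `uv` is an edge, and the cell after it
holds the weight of `uv` if `uv` is an edge. All other cells hold `0`. -/
noncomputable def WGraph.input (G : WGraph) (a : ℕ) : ℤ :=
  if a = 0 then (G.n : ℤ)
  else if h : (a - 1) / 2 / G.n < G.n ∧ (a - 1) / 2 % G.n < G.n then
    if G.graph.Adj ⟨(a - 1) / 2 / G.n, h.1⟩ ⟨(a - 1) / 2 % G.n, h.2⟩ then
      if (a - 1) % 2 = 0 then 1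
      else G.weight s(⟨(a - 1) / 2 / G.n, h.1⟩, ⟨(a - 1) / 2 % G.n, h.2⟩)
    else 0
  else 0

/-- The `k`-clique problem over the tropical semiring: compute the minimum weight of a `k`-clique.
Register `0` says whether there is a `k`-clique (`1`) or not (`0`: the minimum is `∞`); in the
former case register `1` holds the minimum. -/
noncomputable def minWeightClique (k : ℕ) : Problem where
  Inst := WGraph
  size G := G.n
  numbersLE G M := ∀ e ∈ G.graph.edgeSet, |G.weight e| ≤ (M : ℤ)
  input := WGraph.input
  correct G s :=
    (s.reg 0 = 0 ∧ ¬ ∃ K, G.graph.IsNClique k K) ∨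
    (s.reg 0 = 1 ∧ IsLeast {w | ∃ K, G.graph.IsNClique k K ∧ G.cliqueWeight K = w} (s.reg 1))

/-- The Min-Weight `k`-Clique Conjecture: for no `k ≥ 3` and no `ε > 0` can the minimum-weight
`k`-clique problem be solved in time `O(n ^ (k - ε))`. -/
def MinWeightCliqueConjecture : Prop :=
  ∀ k : ℕ, 3 ≤ k → ¬ ∃ ε : ℝ, 0 < ε ∧
    (minWeightClique k).SolvableInTime (fun G : WGraph => (G.n : ℝ) ^ ((k : ℝ) - ε))

/-! ## The star query over the tropical semiring -/

/-- The tropical semiring `(ℝ₊ ∪ {∞}, min, +, ∞, 0)`. -/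
abbrev TropPlus := Tropical ℝ≥0∞

/-- A database for the star query with `ℓ` relations: a list, in any order, of the annotated tuples
of all relations. The entry `((i, x, y), a)` says that the tuple `(x, y)` belongs to the `i`-th
relation and has annotation `a`. A relation holds a tuple at most once. -/
structure StarDB (ℓ : ℕ) where
  facts : List ((Fin ℓ × ℕ × ℕ) × ℕ)
  nodup : (facts.map Prod.fst).Nodup

/-- The `i`-th relation, as a function to the semiring; tuples that are not in the relation are
annotated by the zero of the semiring, which is `∞`. -/
noncomputable def StarDB.rel {ℓ : ℕ} (D : StarDB ℓ) (i : Fin ℓ) (x y : ℕ) : TropPlus :=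
  match D.facts.lookup (i, x, y) with
  | some a => Tropical.trop (a : ℝ≥0∞)
  | none => 0

/-- The values of the variable `y` that occur in the database. -/
def StarDB.yDomain {ℓ : ℕ} (D : StarDB ℓ) : Finset ℕ :=
  (D.facts.map fun f => f.1.2.2).toFinset

/-- The star query `Q(x₁, …, x_ℓ) ← ⨁_y R₁(x₁, y) ⊗ ⋯ ⊗ R_ℓ(x_ℓ, y)`. -/
noncomputable def StarDB.query {ℓ : ℕ} (D : StarDB ℓ) (x : Fin ℓ → ℕ) : TropPlus :=
  ∑ y ∈ D.yDomain, ∏ i, D.rel i (x i) y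

/-- `|D|`, the number of tuples of the database. -/
def StarDB.size {ℓ : ℕ} (D : StarDB ℓ) : ℕ := D.facts.length

/-- `OUT`, the set of tuples of the result. -/
def StarDB.out {ℓ : ℕ} (D : StarDB ℓ) : Set (Fin ℓ → ℕ) := {x | D.query x ≠ 0}

/-- `|OUT|`. -/
noncomputable def StarDB.outSize {ℓ : ℕ} (D : StarDB ℓ) : ℕ := D.out.ncard

theorem StarDB.mem_of_rel_ne_zero {ℓ : ℕ} {D : StarDB ℓ} {i : Fin ℓ} {x y : ℕ}
    (h : D.rel i x y ≠ 0) : x ∈ (D.facts.map fun f => f.1.2.1).toFinset := by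
  unfold StarDB.rel at h
  split at h
  · rename_i a ha
    rw [List.lookup_eq_some_iff] at ha
    obtain ⟨l₁, l₂, h₁, -⟩ := ha
    simp only [List.mem_toFinset, List.mem_map]
    exact ⟨((i, x, y), a), by rw [h₁]; simp, rfl⟩
  · exact absurd rfl h

/-- The result of the query is finite, so that `outSize` is its number of elements. -/
theorem StarDB.out_finite {ℓ : ℕ} (D : StarDB ℓ) : D.out.Finite := by
  refine (Set.Finite.pi' fun _ : Fin ℓ =>
    ((D.facts.map fun f => f.1.2.1).toFinset).finite_toSet).subset ?_
  intro x hx i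
  obtain ⟨y, -, hy⟩ := Finset.exists_ne_zero_of_sum_ne_zero hx
  refine StarDB.mem_of_rel_ne_zero (i := i) (y := y) ?_
  intro h
  exact hy (Finset.prod_eq_zero (Finset.mem_univ i) h)

/-- The database in memory: cell `0` holds `|D|`, and the `j`-th entry `((i, x, y), a)` is stored as
`i, x, y, a` in the four cells from `1 + 4 * j` on. All other cells hold `0`. -/
def StarDB.input {ℓ : ℕ} (D : StarDB ℓ) (a : ℕ) : ℤ :=
  if a = 0 then (D.size : ℤ)
  else match D.facts[(a - 1) / 4]? with
    | none => 0
    | some f =>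
      if (a - 1) % 4 = 0 then ((f.1.1 : ℕ) : ℤ)
      else if (a - 1) % 4 = 1 then (f.1.2.1 : ℤ)
      else if (a - 1) % 4 = 2 then (f.1.2.2 : ℤ)
      else (f.2 : ℤ)

/-- Evaluation of the star query with `ℓ` relations over the tropical semiring: list the tuples of
the result, each exactly once and in any order, with their annotations. Register `0` holds the
number of these tuples and register `1` the address `b` of the list; the `j`-th tuple and its
annotation are stored in the `ℓ + 1` cells from `b + j * (ℓ + 1)` on. -/
noncomputable def starEvaluation (ℓ : ℕ) : Problem where
  Inst := StarDB ℓ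
  size := StarDB.size
  numbersLE D M := ∀ f ∈ D.facts, f.1.2.1 ≤ M ∧ f.1.2.2 ≤ M ∧ f.2 ≤ M
  input := StarDB.input
  correct D s :=
    ∃ (L : List (Fin ℓ → ℕ)) (b : ℕ), L.Nodup ∧ (∀ x, x ∈ L ↔ x ∈ D.out) ∧
      s.reg 0 = (L.length : ℤ) ∧ s.reg 1 = (b : ℤ) ∧
      ∀ (j : ℕ) (hj : j < L.length),
        (∀ i : Fin ℓ, s.mem (b + j * (ℓ + 1) + i) = (L[j] i : ℤ)) ∧
        ∃ v : ℕ, s.mem (b + j * (ℓ + 1) + ℓ) = (v : ℤ) ∧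
          D.query L[j] = Tropical.trop (v : ℝ≥0∞)

end StarTropical

/-! The proof reduces the minimum-weight clique problem with `ℓ + 1` nodes to the star query with
`ℓ` relations. Let every relation contain all `n * n` pairs of nodes, annotated by edge weights.
Then `|D| = ℓ * n ^ 2` and `|OUT| = n ^ ℓ`, and the annotation of `(x₁, …, x_ℓ)` is the cheapest way
to join these nodes to a common node `y`. Adding the weights of the pairs inside `x` and minimising
over all `x` gives the minimum over all tuples of `ℓ + 1` nodes. The query costs `n ^ 2 * (n ^ ℓ) ^
(1 - 1/ℓ - ε) = n ^ (ℓ + 1 - ℓ * ε)`. Everything else, including the summands `|D|` and `|OUT|` of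
the second bound, costs `O(n ^ 2 + n ^ ℓ)`, which is `O(n ^ ℓ)` because `ℓ ≥ 2`. So the saving in
the clique exponent is `min 1 (ℓ * ε)`, against the conjecture for `k = ℓ + 1` (`star_time_le`,
`minWeightClique_solvable`).

Annotations must be non-negative and missing edges must be recognised. Every weight is therefore
raised by a common `shift`, which changes all cliques by the same amount, and a missing edge (or a
repeated node) costs `big`, more than any shifted clique in total. A tuple is thus a clique exactly
if its cost is below `big` (`adj_of_tupleCost_lt`, `tupleCost_lt`, `isLeast_of_starCost`).

The rest realises this on the machine. The given program `P` is relocated, so that it runs on its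
own registers and memory next to those of the clique program (`Simulates.runs`). Around it, three
counting loops compute the shift, write the database and read off the results. Their bodies contain
no jumps: the shift is a sum of squares rather than a maximum, and case distinctions become
arithmetic (`cost`, `ediv_sq_add_one`). Correctness is `cliqueProgram_spec`; `PolyBounded` keeps all
numbers polynomial. -/

namespace StarTropical

/-! ## Runs of a program, straight-line code and loops -/

/-- `Runs P W t s s'`: started in `s`, the program `P` executes `t` instructions, none of which
fails, and is then in `s'`. -/
def Runs (P : Program) (W : ℕ) : ℕ → State → State → Prop
  | 0, s, s' => s' = s
  | t + 1, s, s' => ∃ i s₁, P[s.pc]? = some i ∧ i.exec W s = some s₁ ∧ Runs P W t s₁ s'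

theorem Runs.trans {P : Program} {W t₁ t₂ : ℕ} {s₁ s₂ s₃ : State} (h₁ : Runs P W t₁ s₁ s₂)
    (h₂ : Runs P W t₂ s₂ s₃) : Runs P W (t₁ + t₂) s₁ s₃ := by
  induction t₁ generalizing s₁ with
  | zero =>
    obtain rfl : s₂ = s₁ := h₁
    simpa using h₂
  | succ t ih =>
    obtain ⟨i, s, hi, he, hr⟩ := h₁
    rw [Nat.add_right_comm]
    exact ⟨i, s, hi, he, ih hr⟩

theorem Runs.single {P : Program} {W : ℕ} {s s' : State} {i : Instr} (hi : P[s.pc]? = some i)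
    (he : i.exec W s = some s') : Runs P W 1 s s' :=
  ⟨i, s', hi, he, rfl⟩

theorem Runs.haltsIn {P : Program} {W t : ℕ} {s s' : State} (h : Runs P W t s s')
    (hp : P.length ≤ s'.pc) : HaltsIn P W t s s' := by
  induction t generalizing s with
  | zero =>
    obtain rfl : s' = s := h
    exact ⟨hp, rfl⟩
  | succ t ih =>
    obtain ⟨i, s₁, hi, he, hr⟩ := h
    exact ⟨i, s₁, hi, he, ih hr⟩

/-- The program `P` contains `code` from position `b` on. -/
def CodeAt (P : Program) (b : ℕ) (code : List Instr) : Prop :=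
  ∀ i < code.length, P[b + i]? = code[i]?

theorem CodeAt.head {P : Program} {b : ℕ} {i : Instr} {code : List Instr}
    (h : CodeAt P b (i :: code)) : P[b]? = some i := by
  simpa using h 0 (by simp)

theorem CodeAt.tail {P : Program} {b : ℕ} {i : Instr} {code : List Instr}
    (h : CodeAt P b (i :: code)) : CodeAt P (b + 1) code := by
  intro j hj
  have := h (j + 1) (by simpa using hj)
  rw [show b + 1 + j = b + (j + 1) by omega, this]
  simp

theorem codeAt_append {P : Program} {b : ℕ} {c₁ c₂ : List Instr} :
    CodeAt P b (c₁ ++ c₂) ↔ CodeAt P b c₁ ∧ CodeAt P (b + c₁.length) c₂ := by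
  constructor
  · intro h
    refine ⟨fun i hi => ?_, fun i hi => ?_⟩
    · rw [h i (by simp; omega), List.getElem?_append_left hi]
    · rw [Nat.add_assoc, h (c₁.length + i) (by simp; omega),
        List.getElem?_append_right (by omega)]
      simp
  · rintro ⟨h₁, h₂⟩ i hi
    rcases lt_or_ge i c₁.length with hl | hl
    · rw [h₁ i hl, List.getElem?_append_left hl]
    · have := h₂ (i - c₁.length) (by simp at hi; omega)
      rw [List.getElem?_append_right hl, ← this]
      congr 1
      omega

theorem codeAt_self (P : Program) : CodeAt P 0 P := fun i _ => by simp

/-- The effect of an instruction that is not a jump, on a machine without a word bound. -/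
def Instr.next (s : State) : Instr → State
  | .const r c => ⟨s.pc + 1, Function.update s.reg r c, s.mem⟩
  | .add r a b => ⟨s.pc + 1, Function.update s.reg r (s.reg a + s.reg b), s.mem⟩
  | .sub r a b => ⟨s.pc + 1, Function.update s.reg r (s.reg a - s.reg b), s.mem⟩
  | .mul r a b => ⟨s.pc + 1, Function.update s.reg r (s.reg a * s.reg b), s.mem⟩
  | .div r a b => ⟨s.pc + 1, Function.update s.reg r (s.reg a / s.reg b), s.mem⟩
  | .load r a => ⟨s.pc + 1, Function.update s.reg r (s.mem (s.reg a).toNat), s.mem⟩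
  | .store a r => ⟨s.pc + 1, s.reg, Function.update s.mem (s.reg a).toNat (s.reg r)⟩
  | .jump _ => s
  | .jpos _ _ => s

/-- The instruction is not a jump, does not fail for a reason other than the word bound, and loads
no constant larger than `X`. -/
def Instr.Safe (X : ℕ) (s : State) : Instr → Prop
  | .const _ c => |c| ≤ (X : ℤ)
  | .add _ _ _ => True
  | .sub _ _ _ => True
  | .mul _ _ _ => True
  | .div _ _ b => s.reg b ≠ 0
  | .load _ a => 0 ≤ s.reg a
  | .store a _ => 0 ≤ s.reg a
  | .jump _ => False
  | .jpos _ _ => False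

/-- The effect of straight-line code. -/
def run : List Instr → State → State
  | [], s => s
  | i :: code, s => run code (i.next s)

/-- No instruction of the straight-line code fails for a reason other than the word bound. -/
def SafeRun (X : ℕ) : List Instr → State → Prop
  | [], _ => True
  | i :: code, s => i.Safe X s ∧ SafeRun X code (i.next s)

theorem run_append (c₁ c₂ : List Instr) (s : State) : run (c₁ ++ c₂) s = run c₂ (run c₁ s) := by
  induction c₁ generalizing s with
  | nil => rfl
  | cons i c ih => exact ih _

theorem safeRun_append {X : ℕ} {c₁ c₂ : List Instr} {s : State} :
    SafeRun X (c₁ ++ c₂) s ↔ SafeRun X c₁ s ∧ SafeRun X c₂ (run c₁ s) := by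
  induction c₁ generalizing s with
  | nil => simp [SafeRun, run]
  | cons i c ih => simp [SafeRun, run, ih, and_assoc]

/-- All registers and memory cells hold numbers of absolute value at most `X`. -/
def Bounded (X : ℕ) (s : State) : Prop :=
  (∀ r, |s.reg r| ≤ (X : ℤ)) ∧ ∀ a, |s.mem a| ≤ (X : ℤ)

theorem abs_update_le {f : ℕ → ℤ} {X Y : ℤ} {r : ℕ} {v : ℤ} (hf : ∀ r, |f r| ≤ X) (hXY : X ≤ Y)
    (hv : |v| ≤ Y) (x : ℕ) : |Function.update f r v x| ≤ Y := by
  rw [Function.update_apply]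
  split
  · exact hv
  · exact (hf x).trans hXY

theorem State.setReg_eq {W : ℕ} {s : State} {r : ℕ} {v : ℤ} (h : |v| ≤ (W : ℤ)) :
    s.setReg W r v = some ⟨s.pc + 1, Function.update s.reg r v, s.mem⟩ := if_pos h

/-- Products are at most `X ^ 2`, and so are sums, since `2 * X ≤ X ^ 2` for `X ≥ 2`. All other
instructions create nothing larger than an old value or a constant. -/
theorem Instr.Safe.exec_eq {X Y W : ℕ} {s : State} {i : Instr} (hs : i.Safe Y s) (hYX : Y ≤ X)
    (hX : 2 ≤ X) (hb : Bounded X s) (hW : X ^ 2 ≤ W) :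
    i.exec W s = some (i.next s) ∧ Bounded (X ^ 2) (i.next s) ∧ (i.next s).pc = s.pc + 1 := by
  obtain ⟨hr, hm⟩ := hb
  have hX' : (2 : ℤ) ≤ X := by exact_mod_cast hX
  have hXX : (X : ℤ) ≤ (X ^ 2 : ℕ) := by push_cast; nlinarith
  have hYX' : (Y : ℤ) ≤ X := by exact_mod_cast hYX
  have hW' : ((X ^ 2 : ℕ) : ℤ) ≤ W := by exact_mod_cast hW
  have hadd : ∀ a b : ℤ, |a| ≤ X → |b| ≤ X → |a + b| ≤ (X ^ 2 : ℕ) := fun a b ha hb => by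
    refine (abs_add_le a b).trans ?_
    push_cast
    nlinarith
  have key : ∀ (r : ℕ) (v : ℤ), |v| ≤ (X ^ 2 : ℕ) →
      s.setReg W r v = some ⟨s.pc + 1, Function.update s.reg r v, s.mem⟩ ∧
      Bounded (X ^ 2) ⟨s.pc + 1, Function.update s.reg r v, s.mem⟩ := fun r v hv =>
    ⟨State.setReg_eq (hv.trans hW'), abs_update_le hr hXX hv, fun a => (hm a).trans hXX⟩
  cases i with
  | const r c =>
    have := key r c (le_trans hs (hYX'.trans hXX))
    exact ⟨this.1, this.2, rfl⟩
  | add r a b =>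
    have := key r _ (hadd _ _ (hr a) (hr b))
    exact ⟨this.1, this.2, rfl⟩
  | sub r a b =>
    have := key r (s.reg a - s.reg b) (by
      rw [sub_eq_add_neg]; exact hadd _ _ (hr a) ((abs_neg _).trans_le (hr b)))
    exact ⟨this.1, this.2, rfl⟩
  | mul r a b =>
    have := key r (s.reg a * s.reg b) (by
      rw [abs_mul]; push_cast
      nlinarith [hr a, hr b, abs_nonneg (s.reg a), abs_nonneg (s.reg b)])
    exact ⟨this.1, this.2, rfl⟩
  | div r a b =>
    have := key r (s.reg a / s.reg b) ((Int.abs_ediv_le_abs _ _).trans ((hr a).trans hXX))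
    exact ⟨(if_neg hs).trans this.1, this.2, rfl⟩
  | load r a =>
    have := key r (s.mem (s.reg a).toNat) ((hm _).trans hXX)
    exact ⟨(if_pos hs).trans this.1, this.2, rfl⟩
  | store a r =>
    exact ⟨if_pos hs, ⟨fun r => (hr r).trans hXX, abs_update_le hm hXX ((hr r).trans hXX)⟩, rfl⟩
  | jump t => exact hs.elim
  | jpos r t => exact hs.elim

/-- The bound `Y` on constants is kept apart from `X` because `X` is squared at each step of the
induction while the constants stay fixed. -/
theorem runs_straight_aux {P : Program} {W Y : ℕ} {code : List Instr} {X : ℕ} {s : State}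
    (hX : 2 ≤ X) (hYX : Y ≤ X) (hW : X ^ 2 ^ code.length ≤ W) (hc : CodeAt P s.pc code)
    (hb : Bounded X s) (hs : SafeRun Y code s) :
    Runs P W code.length s (run code s) ∧ (run code s).pc = s.pc + code.length := by
  induction code generalizing s X with
  | nil => exact ⟨rfl, rfl⟩
  | cons i code ih =>
    have hXX : X ≤ X ^ 2 := Nat.le_self_pow two_ne_zero X
    have hW' : (X ^ 2) ^ 2 ^ code.length ≤ W := by
      rw [← pow_mul, ← pow_succ']
      simpa using hW
    obtain ⟨he, hb', hpc⟩ := hs.1.exec_eq (W := W) hYX hX hb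
      ((Nat.le_self_pow (by positivity) _).trans hW')
    have := ih (X := X ^ 2) (s := i.next s) (hX.trans hXX) (hYX.trans hXX) hW'
      (by rw [hpc]; exact hc.tail) hb' hs.2
    refine ⟨⟨i, _, hc.head, he, this.1⟩, ?_⟩
    rw [run, this.2, hpc, List.length_cons]
    omega

/-- Straight-line code squares the bound on the numbers at most once in each instruction. -/
theorem runs_straight {P : Program} {W X : ℕ} {code : List Instr} {s : State}
    (hX : 2 ≤ X) (hW : X ^ 2 ^ code.length ≤ W) (hc : CodeAt P s.pc code)
    (hb : Bounded X s) (hs : SafeRun X code s) :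
    Runs P W code.length s (run code s) ∧ (run code s).pc = s.pc + code.length :=
  runs_straight_aux hX le_rfl hW hc hb hs

/-- A loop at position `b`, which repeats `body` while register `r` is positive. -/
def loopCode (b r : ℕ) (body : List Instr) : List Instr :=
  [.jump (b + 1 + body.length)] ++ body ++ [.jpos r (b + 1)]

theorem length_loopCode (b r : ℕ) (body : List Instr) :
    (loopCode b r body).length = body.length + 2 := by
  simp [loopCode]

/-- The invariant `I` restores the same bound `X` before each pass, so the word length depends on
the length of the body and not on the number of passes. It does not mention the program counter,
hence survives the jumps. The loop is entered at its test, which covers `N = 0`; the time is the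
entering jump, `N` tests with their passes, and the failing test. -/
theorem runs_loop {P : Program} {W X r N b : ℕ} {body : List Instr} {s : State}
    {I : ℕ → (ℕ → ℤ) → (ℕ → ℤ) → Prop}
    (hX : 2 ≤ X) (hW : X ^ 2 ^ body.length ≤ W) (hb : s.pc = b)
    (hc : CodeAt P b (loopCode b r body))
    (h0 : I 0 s.reg s.mem)
    (hI : ∀ i s, i ≤ N → I i s.reg s.mem → Bounded X s ∧ s.reg r = (N : ℤ) - i)
    (hstep : ∀ i s, i < N → I i s.reg s.mem →
      SafeRun X body s ∧ I (i + 1) (run body s).reg (run body s).mem) :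
    ∃ s', I N s'.reg s'.mem ∧ s'.pc = b + (loopCode b r body).length ∧
      Runs P W (2 + N * (body.length + 1)) s s' := by
  rw [length_loopCode]
  obtain ⟨hc', hjp⟩ := codeAt_append.1 hc
  obtain ⟨hj, hbody⟩ := codeAt_append.1 hc'
  simp only [List.length_append, List.length_cons, List.length_nil, zero_add] at hjp hbody
  have hj := hj.head
  have hjp := hjp.head
  have main : ∀ i ≤ N, ∃ s', I i s'.reg s'.mem ∧ s'.pc = b + 1 + body.length ∧
      Runs P W (1 + i * (body.length + 1)) s s' := by
    intro i
    induction i with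
    | zero =>
      intro _
      refine ⟨⟨b + 1 + body.length, s.reg, s.mem⟩, h0, rfl, ?_⟩
      rw [zero_mul]
      exact Runs.single (by rw [hb]; exact hj) rfl
    | succ i ih =>
      intro hi
      obtain ⟨s₁, hI₁, hpc, hr⟩ := ih (by omega)
      obtain ⟨hbd, hreg⟩ := hI i s₁ (by omega) hI₁
      have hback : Runs P W 1 s₁ ⟨b + 1, s₁.reg, s₁.mem⟩ := by
        refine Runs.single (i := .jpos r (b + 1)) (by rw [hpc, ← hjp]; congr 1; omega) ?_
        have : 0 < s₁.reg r := by rw [hreg]; omega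
        simp [Instr.exec, this]
      have hst := hstep i ⟨b + 1, s₁.reg, s₁.mem⟩ (by omega) hI₁
      have hrun := runs_straight (P := P) hX hW hbody
        (s := ⟨b + 1, s₁.reg, s₁.mem⟩) hbd hst.1
      refine ⟨_, hst.2, hrun.2, ?_⟩
      have := (hr.trans hback).trans hrun.1
      rwa [show 1 + (i + 1) * (body.length + 1) =
        1 + i * (body.length + 1) + 1 + body.length by ring]
  obtain ⟨s₁, hI₁, hpc, hr⟩ := main N le_rfl
  refine ⟨⟨b + (body.length + 2), s₁.reg, s₁.mem⟩, hI₁, rfl, ?_⟩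
  rw [show 2 + N * (body.length + 1) = 1 + N * (body.length + 1) + 1 by ring]
  refine hr.trans (Runs.single (i := .jpos r (b + 1)) (by rw [hpc, ← hjp]; congr 1; omega) ?_)
  have : s₁.reg r = 0 := by rw [(hI N s₁ le_rfl hI₁).2]; simp
  simp [Instr.exec, this, hpc]
  omega

end StarTropical

namespace StarTropical

/-! ## Relocation of a program

The relocated program uses the registers from `20` on in place of those from `0` on and the memory
cells from `H` on in place of those from `0` on, where register `4` holds `H`. Each instruction
becomes two; register `12` is used for addresses. -/

/-- The first of the two instructions that an instruction is translated to. -/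
def Instr.relocFst : Instr → Instr
  | .load _ a => .add 12 (a + 20) 4
  | .store a _ => .add 12 (a + 20) 4
  -- Padding: every instruction takes two places, so position `p` always moves to `b + 2 * p`.
  | _ => .const 12 0

/-- The second of the two instructions that an instruction is translated to; `b` is the position of
the relocated program and `len` is the length of the original one. -/
def Instr.relocSnd (b len : ℕ) : Instr → Instr
  | .const r c => .const (r + 20) c
  | .add r x y => .add (r + 20) (x + 20) (y + 20)
  | .sub r x y => .sub (r + 20) (x + 20) (y + 20)
  | .mul r x y => .mul (r + 20) (x + 20) (y + 20)
  | .div r x y => .div (r + 20) (x + 20) (y + 20)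
  | .load r _ => .load (r + 20) 12
  | .store _ r => .store 12 (r + 20)
  -- All targets outside of the original program mean halting; they are sent to the first position
  -- behind the relocated code.
  | .jump t => .jump (b + 2 * min t len)
  | .jpos r t => .jpos (r + 20) (b + 2 * min t len)

def relocCode (b len : ℕ) (P : Program) : List Instr :=
  P.flatMap fun i => [i.relocFst, i.relocSnd b len]

theorem length_relocCode (b len : ℕ) (P : Program) : (relocCode b len P).length = 2 * P.length := by
  induction P with
  | nil => rfl
  | cons i P ih =>
    simp only [relocCode, List.flatMap_cons, List.length_append, List.length_cons,
      List.length_nil] at ih ⊢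
    omega

theorem getElem?_relocCode {b len p : ℕ} {P : Program} {i : Instr} (h : P[p]? = some i) :
    (relocCode b len P)[2 * p]? = some i.relocFst ∧
      (relocCode b len P)[2 * p + 1]? = some (i.relocSnd b len) := by
  induction P generalizing p with
  | nil => simp at h
  | cons j P ih =>
    cases p with
    | zero =>
      simp only [List.getElem?_cons_zero, Option.some.injEq] at h
      subst h
      simp [relocCode]
    | succ p =>
      have := ih (p := p) (by simpa using h)
      simpa [relocCode, Nat.mul_succ] using this

/-- The state `σ` of the relocated program stands for the state `s` of the original one, while
`ρ` and `μ` are the contents of the registers and memory cells that the latter cannot access. -/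
structure Simulates (b len H : ℕ) (ρ μ : ℕ → ℤ) (s σ : State) : Prop where
  pc : σ.pc = b + 2 * min s.pc len
  reg : ∀ r, σ.reg (r + 20) = s.reg r
  mem : ∀ a, σ.mem (H + a) = s.mem a
  regLow : ∀ r < 20, r ≠ 12 → σ.reg r = ρ r
  memLow : ∀ a < H, σ.mem a = μ a

theorem Simulates.setReg {b len H p r pc' : ℕ} {ρ μ : ℕ → ℤ} {s σ : State} {v : ℤ}
    {f : ℕ → ℤ} (h : Simulates b len H ρ μ s σ) (hf : ∀ r, r ≠ 12 → f r = σ.reg r)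
    (hp : pc' = b + 2 * min p len) :
    Simulates b len H ρ μ ⟨p, Function.update s.reg r v, s.mem⟩
      ⟨pc', Function.update f (r + 20) v, σ.mem⟩ where
  pc := hp
  reg x := by
    simp only [Function.update_apply, Nat.add_right_cancel_iff]
    split
    · rfl
    · rw [hf _ (by omega), h.reg]
  mem := h.mem
  regLow x hx hx' :=
    (Function.update_of_ne (by omega) _ _).trans ((hf _ hx').trans (h.regLow x hx hx'))
  memLow := h.memLow

/-- Two word bounds occur besides `W`. The machine checks the bound only when it writes a register,
so the input in memory may exceed `W` and is bounded by `Y`; shifted addresses can reach `Y + H`. -/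
theorem Simulates.step {P Q : Program} {b H W Y W' : ℕ} {ρ μ : ℕ → ℤ}
    {s σ s₁ : State} {i : Instr}
    (hQ : CodeAt Q b (relocCode b P.length P)) (hρ : ρ 4 = H) (hWY : W ≤ Y) (hW : Y + H ≤ W')
    (h : Simulates b P.length H ρ μ s σ) (hb : Bounded Y s) (hi : P[s.pc]? = some i)
    (he : i.exec W s = some s₁) :
    Bounded Y s₁ ∧ ∃ σ₁, Simulates b P.length H ρ μ s₁ σ₁ ∧ Runs Q W' 2 σ σ₁ := by
  have hlt : s.pc < P.length := (List.getElem?_eq_some_iff.1 hi).1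
  have hpc : σ.pc = b + 2 * s.pc := by rw [h.pc, min_eq_left hlt.le]
  have hlen := length_relocCode b P.length P
  have hfst : Q[σ.pc]? = some i.relocFst := by
    rw [hpc, hQ _ (by omega), (getElem?_relocCode hi).1]
  have hsnd : Q[σ.pc + 1]? = some (i.relocSnd b P.length) := by
    rw [hpc, Nat.add_assoc, hQ _ (by omega), (getElem?_relocCode hi).2]
  have hnext : σ.pc + 2 = b + 2 * min (s.pc + 1) P.length := by
    rw [hpc, min_eq_left (by omega)]; omega
  have hWW' : (Y : ℤ) + H ≤ W' := by exact_mod_cast hW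
  have hWY' : (W : ℤ) ≤ Y := by exact_mod_cast hWY
  have h4 : σ.reg 4 = H := by rw [h.regLow 4 (by omega) (by omega), hρ]
  -- the instruction writes a register
  have write : ∀ (r : ℕ) (v : ℤ) (u : ℤ), |u| ≤ (W' : ℤ) → s.setReg W r v = some s₁ →
      i.relocFst.exec W' σ = some ⟨σ.pc + 1, Function.update σ.reg 12 u, σ.mem⟩ →
      (|v| ≤ (W' : ℤ) →
        (i.relocSnd b P.length).exec W' ⟨σ.pc + 1, Function.update σ.reg 12 u, σ.mem⟩ =
          State.setReg W' ⟨σ.pc + 1, Function.update σ.reg 12 u, σ.mem⟩ (r + 20) v) →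
      Bounded Y s₁ ∧ ∃ σ₁, Simulates b P.length H ρ μ s₁ σ₁ ∧ Runs Q W' 2 σ σ₁ := by
    intro r v u hu hs h₁ h₂
    unfold State.setReg at hs
    split at hs
    · rename_i hv
      obtain rfl := Option.some.inj hs
      have hv' : |v| ≤ (W' : ℤ) := by omega
      refine ⟨⟨abs_update_le hb.1 le_rfl (hv.trans hWY'), hb.2⟩, _,
        h.setReg (f := Function.update σ.reg 12 u) (r := r) (v := v)
          (fun x hx => Function.update_of_ne hx _ _) hnext,
        _, _, hfst, h₁, _, _, hsnd, ?_, rfl⟩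
      rw [h₂ hv', State.setReg_eq hv']
    · simp at hs
  have hz : (Instr.const 12 0).exec W' σ =
      some ⟨σ.pc + 1, Function.update σ.reg 12 0, σ.mem⟩ := State.setReg_eq (by simp)
  have hza : |(0 : ℤ)| ≤ W' := by simp
  have hup : ∀ u r, Function.update σ.reg 12 u (r + 20) = s.reg r := fun u r => by
    rw [Function.update_of_ne (by omega), h.reg]
  have haddr : ∀ a, |s.reg a + (H : ℤ)| ≤ W' := fun a => by
    refine (abs_add_le _ _).trans (le_trans ?_ hWW')
    have := hb.1 a
    simpa using this
  have hz' : ∀ a, (Instr.add 12 (a + 20) 4).exec W' σ =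
      some ⟨σ.pc + 1, Function.update σ.reg 12 (s.reg a + H), σ.mem⟩ := fun a => by
    rw [Instr.exec, h4, h.reg]
    exact State.setReg_eq (haddr a)
  have hnat : ∀ a, 0 ≤ s.reg a → (s.reg a + (H : ℤ)).toNat = H + (s.reg a).toNat := by
    intro a ha; omega
  cases i with
  | const r c => exact write r c 0 hza he hz fun _ => rfl
  | add r x y =>
    exact write r _ 0 hza he hz fun _ => by simp only [Instr.relocSnd, Instr.exec, hup]
  | sub r x y =>
    exact write r _ 0 hza he hz fun _ => by simp only [Instr.relocSnd, Instr.exec, hup]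
  | mul r x y =>
    exact write r _ 0 hza he hz fun _ => by simp only [Instr.relocSnd, Instr.exec, hup]
  | div r x y =>
    simp only [Instr.exec] at he
    split at he
    · simp at he
    · rename_i hy
      exact write r _ 0 hza he hz fun _ => by
        simp only [Instr.relocSnd, Instr.exec, hup, if_neg hy]
  | load r a =>
    simp only [Instr.exec] at he
    split at he
    · rename_i ha
      refine write r _ _ (haddr a) he (hz' a) fun _ => ?_
      simp only [Instr.relocSnd, Instr.exec, Function.update_self]
      rw [if_pos (by omega), hnat a ha, h.mem]
    · simp at he
  | store a r =>
    simp only [Instr.exec] at he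
    split at he
    · rename_i ha
      obtain rfl := Option.some.inj he
      refine ⟨⟨hb.1, abs_update_le hb.2 le_rfl (hb.1 r)⟩,
        ⟨σ.pc + 2, Function.update σ.reg 12 (s.reg a + H),
          Function.update σ.mem (H + (s.reg a).toNat) (s.reg r)⟩,
        ⟨hnext, fun x => hup (s.reg a + H) x, fun x => ?_, fun x hx hx' => ?_, fun x hx => ?_⟩,
        _, _, hfst, hz' a, _, _, hsnd, ?_, rfl⟩
      · simp only [Function.update_apply, Nat.add_left_cancel_iff, h.mem]
      · exact (Function.update_of_ne hx' _ _).trans (h.regLow x hx hx')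
      · exact (Function.update_of_ne (by omega) _ _).trans (h.memLow x hx)
      · simp only [Instr.relocSnd, Instr.exec, Function.update_self, hup]
        rw [if_pos (by omega), hnat a ha]
    · simp at he
  | jump t =>
    obtain rfl := Option.some.inj he
    exact ⟨hb, ⟨b + 2 * min t P.length, Function.update σ.reg 12 0, σ.mem⟩,
      ⟨rfl, fun x => hup 0 x, h.mem,
        fun x hx hx' => (Function.update_of_ne hx' _ _).trans (h.regLow x hx hx'), h.memLow⟩,
      _, _, hfst, hz, _, _, hsnd, rfl, rfl⟩
  | jpos r t =>
    obtain rfl := Option.some.inj he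
    refine ⟨hb, ⟨if 0 < s.reg r then b + 2 * min t P.length else σ.pc + 2,
        Function.update σ.reg 12 0, σ.mem⟩,
      ⟨?_, fun x => hup 0 x, h.mem,
        fun x hx hx' => (Function.update_of_ne hx' _ _).trans (h.regLow x hx hx'), h.memLow⟩,
      _, _, hfst, hz, _, _, hsnd, ?_, rfl⟩
    · dsimp only
      split
      · rfl
      · exact hnext
    · simp only [Instr.relocSnd, Instr.exec, hup]

theorem Simulates.runs {P Q : Program} {b H W Y W' t : ℕ} {ρ μ : ℕ → ℤ} {s σ s₁ : State}
    (hQ : CodeAt Q b (relocCode b P.length P)) (hρ : ρ 4 = H) (hWY : W ≤ Y) (hW : Y + H ≤ W')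
    (h : Simulates b P.length H ρ μ s σ) (hb : Bounded Y s) (hr : HaltsIn P W t s s₁) :
    Bounded Y s₁ ∧ ∃ σ₁, Simulates b P.length H ρ μ s₁ σ₁ ∧ σ₁.pc = b + 2 * P.length ∧
      Runs Q W' (2 * t) σ σ₁ := by
  induction t generalizing s σ with
  | zero =>
    obtain ⟨hp, rfl⟩ := hr
    exact ⟨hb, σ, h, by rw [h.pc, min_eq_right hp], rfl⟩
  | succ t ih =>
    obtain ⟨i, s', hi, he, hr⟩ := hr
    obtain ⟨hb', σ', h', hs⟩ := h.step hQ hρ hWY hW hb hi he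
    obtain ⟨hb₁, σ₁, h₁, hpc, hr'⟩ := ih h' hb' hr
    refine ⟨hb₁, σ₁, h₁, hpc, ?_⟩
    rw [show 2 * (t + 1) = 2 + 2 * t by ring]
    exact hs.trans hr'

end StarTropical

namespace StarTropical

/-! ## Shifted weights -/

/-- The pairs `(i, j)` with `i < j`. -/
def pairs (k : ℕ) : Finset (Fin k × Fin k) := {p | p.1 < p.2}

theorem sum_pairs {k : ℕ} (g : Fin k → Fin k → ℤ) :
    ∑ p ∈ pairs k, g p.1 p.2 = ∑ i, ∑ j, if i < j then g i j else 0 := by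
  rw [pairs, Finset.sum_filter, Fintype.sum_prod_type]

/-- Separates the pairs that contain the last index from the others: the former are evaluated by the
star query, with `y` as the last node, the latter are added afterwards. -/
theorem sum_pairs_succ {k : ℕ} (g : Fin (k + 1) → Fin (k + 1) → ℤ) :
    ∑ p ∈ pairs (k + 1), g p.1 p.2 =
      ∑ i : Fin k, g i.castSucc (Fin.last k) +
        ∑ p ∈ pairs k, g p.1.castSucc p.2.castSucc := by
  rw [sum_pairs, sum_pairs fun i j : Fin k => g i.castSucc j.castSucc]
  have h : ∀ i : Fin k, ¬ Fin.last k < i.castSucc := fun i => not_lt.2 (Fin.le_last _)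
  simp [Fin.sum_univ_castSucc, Finset.sum_add_distrib, Fin.castSucc_lt_last, h, add_comm]

/-- Each unordered pair is counted once on the left, whatever the order, and twice on the right. As
the right side does not depend on `f`, ordering by nodes and ordering by indices give the same sum.
-/
theorem two_mul_sum_lt {k : ℕ} {α : Type*} [LinearOrder α] {f : Fin k → α}
    (hf : Function.Injective f) {g : Fin k → Fin k → ℤ} (hg : ∀ i j, g i j = g j i) :
    2 * (∑ i, ∑ j, if f i < f j then g i j else 0) = ∑ i, ∑ j, if i = j then 0 else g i j := by
  have h : (∑ i, ∑ j, if f i < f j then g i j else 0) =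
      ∑ i, ∑ j, if f j < f i then g i j else 0 := by
    rw [Finset.sum_comm]
    exact Finset.sum_congr rfl fun i _ => Finset.sum_congr rfl fun j _ => by rw [hg]
  rw [two_mul]
  nth_rewrite 2 [h]
  rw [← Finset.sum_add_distrib]
  refine Finset.sum_congr rfl fun i _ => ?_
  rw [← Finset.sum_add_distrib]
  refine Finset.sum_congr rfl fun j _ => ?_
  rcases lt_trichotomy (f i) (f j) with h | h | h
  · have : i ≠ j := by rintro rfl; exact lt_irrefl _ h
    simp [h, h.not_gt, this]
  · simp [hf h]
  · have : i ≠ j := by rintro rfl; exact lt_irrefl _ h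
    simp [h, h.not_gt, this]

namespace WGraph
variable (G : WGraph)

/-- An upper bound for the absolute values of all weights: the sum of the squares of all entries of
the weighted adjacency matrix. -/
noncomputable def shift : ℕ :=
  ∑ a ∈ Finset.range (2 * (G.n * G.n)), (G.input (a + 1)).natAbs ^ 2

/-- The weight that stands for a missing edge, when cliques with `k` nodes are sought. -/
noncomputable def big (k : ℕ) : ℕ := 2 * (pairs k).card * G.shift + 1

/-- The shifted weight at the position `p = u * n + v` of the weighted adjacency matrix. -/
noncomputable def cost (k p : ℕ) : ℤ :=
  G.input (2 * p + 1) * (G.input (2 * p + 2) + G.shift - G.big k) + G.big k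

variable {G} {k : ℕ}

theorem input_zero : G.input 0 = G.n := by simp [WGraph.input]

theorem input_odd {p : ℕ} (u v : Fin G.n) (hp : p = u * G.n + v) [Decidable (G.graph.Adj u v)] :
    G.input (2 * p + 1) = if G.graph.Adj u v then 1 else 0 := by
  have hn : 0 < G.n := by have := u.2; omega
  have h1 : p / G.n = u := by
    rw [hp, mul_comm, Nat.mul_add_div hn, Nat.div_eq_of_lt v.2, add_zero]
  have h2 : p % G.n = v := by rw [hp, mul_comm, Nat.mul_add_mod, Nat.mod_eq_of_lt v.2]
  have h3 : (2 * p + 1 - 1) / 2 = p := by omega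
  simp only [WGraph.input, h3, h1, h2, Fin.is_lt, true_and, dite_true, Fin.eta]
  simp

theorem input_even {p : ℕ} (u v : Fin G.n) (hp : p = u * G.n + v) (h : G.graph.Adj u v) :
    G.input (2 * p + 2) = G.weight s(u, v) := by
  have hn : 0 < G.n := by have := u.2; omega
  have h1 : p / G.n = u := by
    rw [hp, mul_comm, Nat.mul_add_div hn, Nat.div_eq_of_lt v.2, add_zero]
  have h2 : p % G.n = v := by rw [hp, mul_comm, Nat.mul_add_mod, Nat.mod_eq_of_lt v.2]
  have h3 : (2 * p + 2 - 1) / 2 = p := by omega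
  simp only [WGraph.input, h3, h1, h2, Fin.is_lt, true_and, dite_true, Fin.eta]
  rw [if_neg (by omega), if_pos (by simpa only [h3, h1, h2] using h), if_neg (by omega)]

theorem input_eq_zero {a : ℕ} (ha : 2 * (G.n * G.n) < a) : G.input a = 0 := by
  rw [WGraph.input, if_neg (by omega), dif_neg]
  rintro ⟨h, -⟩
  rcases Nat.eq_zero_or_pos G.n with h0 | h0
  · rw [h0] at h
    omega
  · rw [Nat.div_lt_iff_lt_mul h0] at h
    omega

theorem abs_input_le {A : ℕ} (hA : ∀ e ∈ G.graph.edgeSet, |G.weight e| ≤ (A : ℤ)) (a : ℕ) :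
    |G.input a| ≤ ((G.n + 1 + A : ℕ) : ℤ) := by
  push_cast
  unfold WGraph.input
  split_ifs with h1 h2 h3 h4
  · rw [abs_of_nonneg] <;> omega
  · rw [abs_of_nonneg] <;> omega
  · have := hA _ ((SimpleGraph.mem_edgeSet _).2 h3)
    omega
  · simp only [abs_zero]; omega
  · simp only [abs_zero]; omega

theorem shift_le {A : ℕ} (hA : ∀ e ∈ G.graph.edgeSet, |G.weight e| ≤ (A : ℤ)) :
    G.shift ≤ 2 * (G.n * G.n) * (G.n + 1 + A) ^ 2 := by
  refine (Finset.sum_le_card_nsmul _ _ ((G.n + 1 + A) ^ 2) fun a _ => ?_).trans (by simp)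
  have := abs_input_le hA (a + 1)
  rw [Int.abs_eq_natAbs] at this
  exact Nat.pow_le_pow_left (by exact_mod_cast this) 2

theorem pos_lt {u v : ℕ} (hu : u < G.n) (hv : v < G.n) : u * G.n + v < G.n * G.n := by
  nlinarith

theorem abs_weight_le {u v : Fin G.n} (h : G.graph.Adj u v) : |G.weight s(u, v)| ≤ G.shift := by
  have hp := pos_lt u.2 v.2
  have h1 : (G.input (2 * (u * G.n + v) + 1 + 1)).natAbs ^ 2 ≤ G.shift :=
    Finset.single_le_sum (f := fun a => (G.input (a + 1)).natAbs ^ 2) (fun _ _ => Nat.zero_le _)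
      (Finset.mem_range.2 (by omega))
  rw [input_even u v rfl h] at h1
  have h2 := Nat.le_self_pow two_ne_zero (G.weight s(u, v)).natAbs
  rw [Int.abs_eq_natAbs]
  exact_mod_cast h2.trans h1

/-- The adjacency bit acts as a multiplier in `cost`: bit `1` cancels `big`, bit `0` leaves only
`big`. -/
theorem cost_of_adj {p : ℕ} {u v : Fin G.n} (hp : p = u * G.n + v) (h : G.graph.Adj u v) :
    G.cost k p = G.weight s(u, v) + G.shift := by
  classical
  rw [cost, input_odd u v hp, input_even u v hp h, if_pos h]
  ring

theorem cost_of_not_adj {p : ℕ} {u v : Fin G.n} (hp : p = u * G.n + v) (h : ¬ G.graph.Adj u v) :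
    G.cost k p = G.big k := by
  classical
  rw [cost, input_odd u v hp, if_neg h]
  ring

theorem cost_nonneg {u v : ℕ} (hu : u < G.n) (hv : v < G.n) : 0 ≤ G.cost k (u * G.n + v) := by
  by_cases h : G.graph.Adj ⟨u, hu⟩ ⟨v, hv⟩
  · rw [cost_of_adj (u := ⟨u, hu⟩) (v := ⟨v, hv⟩) rfl h]
    have := abs_weight_le h
    have := neg_abs_le (G.weight s(⟨u, hu⟩, ⟨v, hv⟩))
    omega
  · rw [cost_of_not_adj (u := ⟨u, hu⟩) (v := ⟨v, hv⟩) rfl h]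
    omega

theorem cost_nonneg' {p : ℕ} (hp : p < G.n * G.n) : 0 ≤ G.cost k p := by
  have hn : 0 < G.n := Nat.pos_of_ne_zero fun h => by simp [h] at hp
  have := cost_nonneg (G := G) (k := k) (u := p / G.n) (v := p % G.n)
    ((Nat.div_lt_iff_lt_mul hn).2 hp) (Nat.mod_lt _ hn)
  rwa [Nat.div_add_mod'] at this

theorem cost_le {p : ℕ} (hp : p < G.n * G.n) : G.cost k p ≤ 2 * G.shift + G.big k := by
  have hn : 0 < G.n := Nat.pos_of_ne_zero fun h => by simp [h] at hp
  have hu : p / G.n < G.n := (Nat.div_lt_iff_lt_mul hn).2 hp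
  have hv := Nat.mod_lt p hn
  have hp' : p = p / G.n * G.n + p % G.n := (Nat.div_add_mod' _ _).symm
  by_cases h : G.graph.Adj ⟨p / G.n, hu⟩ ⟨p % G.n, hv⟩
  · rw [cost_of_adj (u := ⟨p / G.n, hu⟩) (v := ⟨p % G.n, hv⟩) hp' h]
    have := abs_weight_le h
    have := le_abs_self (G.weight s(⟨p / G.n, hu⟩, ⟨p % G.n, hv⟩))
    omega
  · rw [cost_of_not_adj (u := ⟨p / G.n, hu⟩) (v := ⟨p % G.n, hv⟩) hp' h]
    omega

/-! ### Cliques as tuples of cost below `big`. -/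

/-- The total shifted weight of a tuple of nodes. -/
noncomputable def tupleCost (z : Fin k → Fin G.n) : ℤ :=
  ∑ p ∈ pairs k, G.cost k (z p.1 * G.n + z p.2)

theorem tupleCost_eq {z : Fin k → Fin G.n} (hz : ∀ i j, i < j → G.graph.Adj (z i) (z j)) :
    tupleCost z = ∑ p ∈ pairs k, G.weight s(z p.1, z p.2) + (pairs k).card * G.shift := by
  rw [tupleCost, Finset.sum_congr rfl fun p hp => cost_of_adj (u := z p.1) (v := z p.2) rfl
    (hz _ _ (by simpa [pairs] using hp)), Finset.sum_add_distrib]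
  simp

/-- A single missing edge already costs `big`, and no other pair has negative cost. -/
theorem adj_of_tupleCost_lt {z : Fin k → Fin G.n} (h : tupleCost z < G.big k) {i j : Fin k}
    (hij : i < j) : G.graph.Adj (z i) (z j) := by
  by_contra hn
  have := Finset.single_le_sum (f := fun p : Fin k × Fin k => G.cost k (z p.1 * G.n + z p.2))
    (s := pairs k) (fun p _ => cost_nonneg (z p.1).2 (z p.2).2) (a := (i, j))
    (by simpa [pairs] using hij)
  have h' := cost_of_not_adj (k := k) rfl hn
  simp only [h'] at this
  exact absurd h (not_lt.2 this)

/-- Each of the pairs costs at most `2 * shift`; the summand `1` in `big` makes the inequality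
strict. -/
theorem tupleCost_lt {z : Fin k → Fin G.n} (hz : ∀ i j, i < j → G.graph.Adj (z i) (z j)) :
    tupleCost z < G.big k := by
  rw [tupleCost_eq hz]
  have : ∑ p ∈ pairs k, G.weight s(z p.1, z p.2) ≤ (pairs k).card • (G.shift : ℤ) :=
    Finset.sum_le_card_nsmul _ _ _ fun p hp =>
      (le_abs_self _).trans (abs_weight_le (hz _ _ (by simpa [pairs] using hp)))
  rw [big]
  push_cast
  rw [nsmul_eq_mul] at this
  linarith

theorem cliqueWeight_map {z : Fin k → Fin G.n} (hz : Function.Injective z) :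
    G.cliqueWeight (Finset.univ.map ⟨z, hz⟩) = ∑ p ∈ pairs k, G.weight s(z p.1, z p.2) := by
  have hs : ∀ i j, G.weight s(z i, z j) = G.weight s(z j, z i) := fun i j => by
    rw [Sym2.eq_swap]
  have h1 := two_mul_sum_lt hz hs
  have h2 := two_mul_sum_lt Function.injective_id hs
  rw [sum_pairs fun i j => G.weight s(z i, z j)]
  simp only [WGraph.cliqueWeight, Finset.sum_filter, Finset.sum_map, Function.Embedding.coeFn_mk,
    id] at *
  linarith

/-- The graph has no loops, so tuples with a repeated node need no separate treatment: they contain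
a missing edge. -/
theorem injective_of_adj {z : Fin k → Fin G.n} (hz : ∀ i j, i < j → G.graph.Adj (z i) (z j)) :
    Function.Injective z := by
  intro i j h
  rcases lt_trichotomy i j with hij | hij | hij
  · exact absurd h (hz i j hij).ne
  · exact hij
  · exact absurd h.symm (hz j i hij).ne

theorem exists_clique {z : Fin k → Fin G.n} (hz : ∀ i j, i < j → G.graph.Adj (z i) (z j)) :
    ∃ K, G.graph.IsNClique k K ∧ G.cliqueWeight K = tupleCost z - (pairs k).card * G.shift := by
  have hi := injective_of_adj hz
  refine ⟨Finset.univ.map ⟨z, hi⟩, ⟨?_, by simp⟩, ?_⟩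
  · intro u hu v hv huv
    simp only [Finset.coe_map, Function.Embedding.coeFn_mk, Finset.coe_univ, Set.image_univ,
      Set.mem_range] at hu hv
    obtain ⟨i, rfl⟩ := hu
    obtain ⟨j, rfl⟩ := hv
    rcases lt_trichotomy i j with hij | rfl | hij
    · exact hz i j hij
    · exact absurd rfl huv
    · exact (hz j i hij).symm
  · rw [cliqueWeight_map, tupleCost_eq hz]
    ring

theorem exists_tuple {K : Finset (Fin G.n)} (hK : G.graph.IsNClique k K) :
    ∃ z : Fin k → Fin G.n, (∀ i j, i < j → G.graph.Adj (z i) (z j)) ∧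
      G.cliqueWeight K = tupleCost z - (pairs k).card * G.shift := by
  let e := K.orderEmbOfFin hK.card_eq
  have hz : ∀ i j, i < j → G.graph.Adj (e i) (e j) := fun i j hij =>
    hK.isClique (K.orderEmbOfFin_mem _ i) (K.orderEmbOfFin_mem _ j) (e.strictMono hij).ne
  refine ⟨e, hz, ?_⟩
  rw [tupleCost_eq hz, add_sub_cancel_right, ← cliqueWeight_map (z := e) e.injective]
  congr 1
  ext u
  have := Set.ext_iff.1 (K.range_orderEmbOfFin hK.card_eq) u
  rw [Set.mem_range, Finset.mem_coe] at this
  rw [← this]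
  simp only [Finset.mem_map, Finset.mem_univ, true_and, Function.Embedding.coeFn_mk, e]

/-- The total shifted weight of `x₁, …, x_ℓ, y`. -/
noncomputable def starCost (G : WGraph) {ℓ : ℕ} (x : Fin ℓ → ℕ) (y : ℕ) : ℤ :=
  ∑ i, G.cost (ℓ + 1) (x i * G.n + y) +
    ∑ p ∈ pairs ℓ, G.cost (ℓ + 1) (x p.1 * G.n + x p.2)

theorem tupleCost_snoc {ℓ : ℕ} (x : Fin ℓ → Fin G.n) (y : Fin G.n) :
    tupleCost (Fin.snoc (α := fun _ => Fin G.n) x y) = G.starCost (fun i => (x i : ℕ)) y := by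
  rw [tupleCost, sum_pairs_succ fun i j => G.cost (ℓ + 1)
    ((Fin.snoc (α := fun _ => Fin G.n) x y i : Fin G.n) * G.n +
      (Fin.snoc (α := fun _ => Fin G.n) x y j : Fin G.n))]
  simp [starCost]

/-- Here `m` is the minimum of `big` and all star costs, which is what the third loop computes.
Below `big` it is attained by a clique; if it equals `big`, every clique is excluded by
`tupleCost_lt`. -/
theorem isLeast_of_starCost {ℓ : ℕ} {m : ℤ} (hB : m ≤ G.big (ℓ + 1))
    (hle : ∀ x : Fin ℓ → ℕ, (∀ i, x i < G.n) → ∀ y < G.n, m ≤ G.starCost x y)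
    (hex : m = G.big (ℓ + 1) ∨
      ∃ x : Fin ℓ → ℕ, (∀ i, x i < G.n) ∧ ∃ y < G.n, m = G.starCost x y) :
    (m < G.big (ℓ + 1) ∧ IsLeast {w | ∃ K, G.graph.IsNClique (ℓ + 1) K ∧ G.cliqueWeight K = w}
      (m - (pairs (ℓ + 1)).card * G.shift)) ∨
    (m = G.big (ℓ + 1) ∧ ¬ ∃ K, G.graph.IsNClique (ℓ + 1) K) := by
  have lower : ∀ z : Fin (ℓ + 1) → Fin G.n, m ≤ tupleCost z := fun z => by
    have := tupleCost_snoc (Fin.init (α := fun _ => Fin G.n) z) (z (Fin.last ℓ))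
    rw [Fin.snoc_init_self] at this
    rw [this]
    exact hle _ (fun i => Fin.is_lt _) _ (Fin.is_lt _)
  rcases hB.lt_or_eq with hlt | heq
  · refine .inl ⟨hlt, ?_, ?_⟩
    · obtain ⟨x, hx, y, hy, hm⟩ := hex.resolve_left hlt.ne
      have h := tupleCost_snoc (fun i => (⟨x i, hx i⟩ : Fin G.n)) ⟨y, hy⟩
      obtain ⟨K, hK, hw⟩ := exists_clique
        fun i j hij => adj_of_tupleCost_lt (h.trans hm.symm ▸ hlt) hij
      exact ⟨K, hK, by rw [hw, h, hm]⟩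
    · rintro w ⟨K, hK, rfl⟩
      obtain ⟨z, -, hw⟩ := exists_tuple hK
      rw [hw]
      exact sub_le_sub_right (lower z) _
  · refine .inr ⟨heq, ?_⟩
    rintro ⟨K, hK⟩
    obtain ⟨z, hz, -⟩ := exists_tuple hK
    exact absurd ((lower z).trans_lt (tupleCost_lt hz)) (by omega)

end WGraph

/-! ## The database of a weighted graph -/

namespace WGraph
variable (G : WGraph) (ℓ : ℕ) [NeZero ℓ]

/-- The database whose `ℓ` relations hold all pairs of nodes, annotated by their shifted
weights. -/
noncomputable def starDB : StarDB ℓ where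
  -- The index `q` encodes the relation `q % ℓ` and the matrix position `q / ℓ`, so one loop with
  -- divisions can write all facts.
  facts := (List.range (ℓ * (G.n * G.n))).map fun q =>
    ((Fin.ofNat ℓ q, q / ℓ / G.n, q / ℓ % G.n), (G.cost (ℓ + 1) (q / ℓ)).toNat)
  nodup := by
    rw [List.map_map]
    refine List.Nodup.map (fun q r h => ?_) List.nodup_range
    simp only [Function.comp_apply, Prod.mk.injEq, Fin.ext_iff, Fin.val_ofNat] at h
    obtain ⟨h1, h2, h3⟩ := h
    have h4 : q / ℓ = r / ℓ := by
      rw [← Nat.div_add_mod (q / ℓ) G.n, ← Nat.div_add_mod (r / ℓ) G.n, h2, h3]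
    rw [← Nat.div_add_mod q ℓ, ← Nat.div_add_mod r ℓ, h1, h4]

variable {G ℓ}

theorem size_starDB : (G.starDB ℓ).size = ℓ * (G.n * G.n) := by simp [StarDB.size, starDB]

theorem mem_facts_starDB {i : Fin ℓ} {x y a : ℕ} : ((i, x, y), a) ∈ (G.starDB ℓ).facts ↔
    x < G.n ∧ y < G.n ∧ a = (G.cost (ℓ + 1) (x * G.n + y)).toNat := by
  have hℓ : 0 < ℓ := Nat.pos_of_neZero ℓ
  simp only [starDB, List.mem_map, List.mem_range, Prod.mk.injEq]
  constructor
  · rintro ⟨q, hq, ⟨-, rfl, rfl⟩, rfl⟩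
    have hp : q / ℓ < G.n * G.n := (Nat.div_lt_iff_lt_mul hℓ).2 (by rwa [mul_comm])
    have hn : 0 < G.n := Nat.pos_of_ne_zero fun h => by simp [h] at hp
    exact ⟨(Nat.div_lt_iff_lt_mul hn).2 hp, Nat.mod_lt _ hn, by rw [Nat.div_add_mod']⟩
  · rintro ⟨hx, hy, rfl⟩
    have hp := pos_lt hx hy
    have hdiv : (ℓ * (x * G.n + y) + i) / ℓ = x * G.n + y := by
      rw [Nat.mul_add_div hℓ, Nat.div_eq_of_lt i.2, add_zero]
    refine ⟨ℓ * (x * G.n + y) + i, ?_, ⟨?_, ?_, ?_⟩, ?_⟩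
    · have := i.2
      nlinarith
    · ext
      rw [Fin.val_ofNat, Nat.mul_add_mod, Nat.mod_eq_of_lt i.2]
    · rw [hdiv, mul_comm, Nat.mul_add_div (by omega), Nat.div_eq_of_lt hy, add_zero]
    · rw [hdiv, mul_comm, Nat.mul_add_mod, Nat.mod_eq_of_lt hy]
    · rw [hdiv]

end WGraph

theorem lookup_eq_some_of_mem {α β : Type*} [BEq α] [LawfulBEq α] {l : List (α × β)}
    (hl : (l.map Prod.fst).Nodup) {a : α} {b : β} (h : (a, b) ∈ l) : l.lookup a = some b := by
  induction l with
  | nil => simp at h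
  | cons c l ih =>
    obtain ⟨a', b'⟩ := c
    simp only [List.map_cons, List.nodup_cons] at hl
    rw [List.lookup_cons]
    rcases List.mem_cons.1 h with h' | h'
    · cases h'; simp
    · have hne : a ≠ a' := by
        rintro rfl
        exact hl.1 (List.mem_map_of_mem (f := Prod.fst) h')
      rw [beq_false_of_ne hne]
      exact ih hl.2 h'

/-! ### The result of the query on the database of a graph. -/

namespace WGraph
variable {G : WGraph} {ℓ : ℕ} [NeZero ℓ]

theorem rel_starDB {i : Fin ℓ} {x y : ℕ} (hx : x < G.n) (hy : y < G.n) :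
    (G.starDB ℓ).rel i x y =
      Tropical.trop (((G.cost (ℓ + 1) (x * G.n + y)).toNat : ℕ) : ℝ≥0∞) := by
  rw [StarDB.rel, lookup_eq_some_of_mem (G.starDB ℓ).nodup (mem_facts_starDB.2 ⟨hx, hy, rfl⟩)]

theorem mem_yDomain_starDB {y : ℕ} : y ∈ (G.starDB ℓ).yDomain ↔ y < G.n := by
  simp only [StarDB.yDomain, List.mem_toFinset, List.mem_map]
  constructor
  · rintro ⟨⟨⟨i, x, y⟩, a⟩, h, rfl⟩
    exact (mem_facts_starDB.1 h).2.1
  · intro hy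
    exact ⟨((0, y, y), (G.cost (ℓ + 1) (y * G.n + y)).toNat),
      mem_facts_starDB.2 ⟨hy, hy, rfl⟩, rfl⟩

theorem lt_of_rel_starDB_ne_zero {i : Fin ℓ} {x y : ℕ} (h : (G.starDB ℓ).rel i x y ≠ 0) :
    x < G.n := by
  have := StarDB.mem_of_rel_ne_zero h
  simp only [List.mem_toFinset, List.mem_map] at this
  obtain ⟨⟨⟨i', x', y'⟩, a⟩, hm, rfl⟩ := this
  exact (mem_facts_starDB.1 hm).1

theorem untrop_query_starDB {x : Fin ℓ → ℕ} (hx : ∀ i, x i < G.n) :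
    Tropical.untrop ((G.starDB ℓ).query x) = (G.starDB ℓ).yDomain.inf
      fun y => ((∑ i, (G.cost (ℓ + 1) (x i * G.n + y)).toNat : ℕ) : ℝ≥0∞) := by
  rw [StarDB.query, Finset.untrop_sum']
  refine Finset.inf_congr rfl fun y hy => ?_
  rw [Function.comp_apply, untrop_prod, Nat.cast_sum]
  refine Finset.sum_congr rfl fun i _ => ?_
  rw [rel_starDB (hx i) (mem_yDomain_starDB.1 hy), Tropical.untrop_trop]

theorem mem_out_starDB {x : Fin ℓ → ℕ} : x ∈ (G.starDB ℓ).out ↔ ∀ i, x i < G.n := by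
  constructor
  · intro h i
    obtain ⟨y, -, hy⟩ := Finset.exists_ne_zero_of_sum_ne_zero h
    exact lt_of_rel_starDB_ne_zero (i := i) (y := y) fun h =>
      hy (Finset.prod_eq_zero (Finset.mem_univ i) h)
  · intro hx h
    have h' := untrop_query_starDB hx
    -- As `ℓ` is positive, `x 0` is a node; this rules out an empty minimum, which would be `∞`.
    have h0 : x 0 ∈ (G.starDB ℓ).yDomain := mem_yDomain_starDB.2 (hx 0)
    have hle := Finset.inf_le (f := fun y =>
      ((∑ i, (G.cost (ℓ + 1) (x i * G.n + y)).toNat : ℕ) : ℝ≥0∞)) h0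
    rw [← h', h, Tropical.untrop_zero, top_le_iff] at hle
    exact ENNReal.natCast_ne_top _ hle

theorem outSize_starDB : (G.starDB ℓ).outSize = G.n ^ ℓ := by
  have : (G.starDB ℓ).out = (Fintype.piFinset fun _ : Fin ℓ => Finset.range G.n : Set _) := by
    ext x
    simp [mem_out_starDB]
  rw [StarDB.outSize, this, Set.ncard_coe_finset]
  simp

/-- Takes the infimum in the extended reals back to an attained minimum of integers; truncation by
`toNat` is harmless because costs are non-negative. -/
theorem query_starDB_eq {x : Fin ℓ → ℕ} (hx : ∀ i, x i < G.n) {v : ℕ}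
    (hv : (G.starDB ℓ).query x = Tropical.trop (v : ℝ≥0∞)) :
    (∀ y < G.n, (v : ℤ) ≤ ∑ i, G.cost (ℓ + 1) (x i * G.n + y)) ∧
      ∃ y < G.n, (v : ℤ) = ∑ i, G.cost (ℓ + 1) (x i * G.n + y) := by
  have h := untrop_query_starDB hx
  rw [hv, Tropical.untrop_trop] at h
  have hcast : ∀ y < G.n, ((∑ i, (G.cost (ℓ + 1) (x i * G.n + y)).toNat : ℕ) : ℤ) =
      ∑ i, G.cost (ℓ + 1) (x i * G.n + y) := fun y hy => by
    rw [Nat.cast_sum]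
    exact Finset.sum_congr rfl fun i _ => Int.toNat_of_nonneg (cost_nonneg (hx i) hy)
  constructor
  · intro y hy
    have := h.trans_le (Finset.inf_le (mem_yDomain_starDB.2 hy))
    rw [← hcast y hy]
    exact_mod_cast this
  · obtain ⟨y, hy, hy'⟩ := Finset.exists_mem_eq_inf (G.starDB ℓ).yDomain
      ⟨x 0, mem_yDomain_starDB.2 (hx 0)⟩
      (fun y => ((∑ i, (G.cost (ℓ + 1) (x i * G.n + y)).toNat : ℕ) : ℝ≥0∞))
    have hyn := mem_yDomain_starDB.1 hy
    refine ⟨y, hyn, ?_⟩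
    rw [← hcast y hyn]
    exact_mod_cast h.trans hy'

end WGraph
end StarTropical

namespace StarTropical

/-! ## The program around the evaluation of the star query

Register `2` holds the number `n` of nodes, `3` holds `n * n`, `4` the address of the database, `5`
the shift of the weights, `6` the weight of a missing edge, `7` the number `1`, `10` the number `ℓ`
of relations, and `11` the minimum found so far. -/

/-- Register `0` is initially `0`, so the first load fetches `n`. The matrix ends at cell `2 * n *
n`, and the database starts right after it. Register `9` is the counter of the first loop. -/
def initCode : List Instr :=
  [.load 2 0, .const 7 1, .mul 3 2 2, .add 4 3 3, .add 4 4 7, .add 9 3 3]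

/-- Adds the square of one memory cell to register `5`. -/
def shiftBody : List Instr :=
  [.add 8 8 7, .load 12 8, .mul 12 12 12, .add 5 5 12, .sub 9 9 7, .const 12 0]

/-- Besides the cost of a missing edge, this prepares the counters of the second loop and writes the
header cell of the database, its size. -/
def bigCode (ℓ : ℕ) : List Instr :=
  [.const 12 (2 * (pairs (ℓ + 1)).card : ℕ), .mul 6 12 5, .add 6 6 7, .const 8 0, .const 10 ℓ,
    .mul 9 10 3, .store 4 9, .const 12 0]

/-- Writes the shifted weight at the position held by register `12` to register `16`. -/
def costCode : List Instr :=
  [.add 16 12 12, .add 16 16 7, .load 17 16, .add 16 16 7, .load 16 16, .add 16 16 5,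
    .sub 16 16 6, .mul 16 17 16, .add 16 16 6]

def splitCode : List Instr :=
  [.div 12 8 10, .mul 13 12 10, .sub 13 8 13, .div 14 12 2, .mul 15 14 2, .sub 15 12 15]

/-- The fact with index `q` starts `1 + 4 * q` cells after the beginning of the database. The final
constants clear the scratch registers, which keeps the invariant and its bound simple. -/
def writeCode : List Instr :=
  [.add 17 8 8, .add 17 17 17, .add 17 17 4, .add 17 17 7, .store 17 13, .add 17 17 7,
    .store 17 14, .add 17 17 7, .store 17 15, .add 17 17 7, .store 17 16, .add 8 8 7, .sub 9 9 7,
    .const 12 0, .const 13 0, .const 14 0, .const 15 0, .const 16 0, .const 17 0]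

/-- Writes one annotated tuple of the database. -/
def tupleBody : List Instr := splitCode ++ (costCode ++ writeCode)

def indexCode {ℓ : ℕ} (p : Fin ℓ × Fin ℓ) : List Instr :=
  [.const 12 (p.1 : ℕ), .add 12 12 21, .load 12 12, .mul 12 12 2,
    .const 14 (p.2 : ℕ), .add 14 14 21, .load 14 14, .add 12 12 14]

/-- Adds the shifted weight of one pair of nodes of a tuple to register `13`. -/
def pairCode {ℓ : ℕ} (p : Fin ℓ × Fin ℓ) : List Instr :=
  indexCode p ++ (costCode ++ [.add 13 13 16])

def annotationCode (ℓ : ℕ) : List Instr := [.const 12 ℓ, .add 12 12 21, .load 13 12]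

/-- With `d = a - b`, the quotient `d / (d * d + 1)` is `-1` or `0` according to the sign of `d`,
and `b - (d / (d * d + 1)) * d` is the minimum of `a` and `b`. -/
def minCode : List Instr :=
  [.sub 12 11 13, .mul 14 12 12, .add 14 14 7, .div 14 12 14, .mul 14 14 12, .sub 11 13 14,
    .sub 20 20 7, .add 21 21 10, .add 21 21 7, .const 12 0, .const 13 0, .const 14 0, .const 16 0,
    .const 17 0]

/-- Accounts for one tuple of the result of the query. -/
noncomputable def resultBody (ℓ : ℕ) : List Instr :=
  annotationCode ℓ ++ ((pairs ℓ).toList.flatMap pairCode ++ minCode)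

/-- Register `21` is register `1` of the relocated program; adding the offset turns its list address
into a real one. Register `11` is still `0` and becomes `big`, the start of the minimum. -/
def resultCode : List Instr := [.add 21 21 4, .add 11 11 6]

/-- The sign trick of `minCode` tells whether the minimum is below `big`; the total shift of a
clique is then subtracted. -/
def answerCode (ℓ : ℕ) : List Instr :=
  [.sub 12 11 6, .mul 13 12 12, .add 13 13 7, .div 0 12 13, .const 14 0, .sub 0 14 0,
    .const 12 ((pairs (ℓ + 1)).card : ℕ), .mul 12 12 5, .sub 1 11 12]

/-- The numbers that occur outside of the evaluation of the query are at most `X`. -/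
structure Large (G : WGraph) (ℓ X : ℕ) : Prop where
  two : 2 ≤ X
  ell : ℓ ≤ X
  card : 2 * (pairs (ℓ + 1)).card ≤ X
  node : G.n ≤ X
  head : 2 * (G.n * G.n) + 1 ≤ X
  size : ℓ * (G.n * G.n) ≤ X
  big : 2 * G.shift + G.big (ℓ + 1) ≤ X
  out : G.n ^ ℓ * (ℓ + 1) ≤ X
  input : ∀ a, |G.input a| ≤ (X : ℤ)

theorem costCode_spec {k X : ℕ} {G : WGraph} {s : State} {p : ℕ} (h5 : s.reg 5 = G.shift)
    (h6 : s.reg 6 = G.big k) (h7 : s.reg 7 = 1) (h12 : s.reg 12 = p)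
    (hp : p < G.n * G.n) (hm : ∀ a < 2 * (G.n * G.n) + 1, s.mem a = G.input a) :
    SafeRun X costCode s ∧ (run costCode s).mem = s.mem ∧ (run costCode s).reg 16 = G.cost k p ∧
      ∀ r, r ≠ 16 → r ≠ 17 → (run costCode s).reg r = s.reg r := by
  have e1 : ((p : ℤ) + p + 1).toNat = 2 * p + 1 := by omega
  have e2 : ((p : ℤ) + p + 1 + 1).toNat = 2 * p + 2 := by omega
  refine ⟨?_, rfl, ?_, ?_⟩
  · simp [costCode, SafeRun, Instr.Safe, Instr.next, h12, h7]
    omega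
  · simp [costCode, run, Instr.next, h12, h7, h5, h6, e1, e2, hm (2 * p + 1) (by omega),
      hm (2 * p + 2) (by omega), WGraph.cost]
  · intro r h h'
    simp [costCode, run, Instr.next, h, h']

/-! ### The first loop: the shift as a sum of squares. -/

section shift
variable {G : WGraph}

/-- The invariant of the first loop. -/
structure ShiftInv (G : WGraph) (q : ℕ) (reg mem : ℕ → ℤ) : Prop where
  mem : mem = G.input
  r2 : reg 2 = G.n
  r3 : reg 3 = G.n * G.n
  r4 : reg 4 = 2 * (G.n * G.n) + 1
  r5 : reg 5 = ((∑ a ∈ Finset.range q, (G.input (a + 1)).natAbs ^ 2 : ℕ) : ℤ)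
  r7 : reg 7 = 1
  r8 : reg 8 = q
  r9 : reg 9 = 2 * (G.n * G.n) - q
  other : ∀ r, r ∉ [2, 3, 4, 5, 7, 8, 9] → reg r = 0

theorem initCode_spec {X : ℕ} :
    SafeRun (X + 1) initCode (initState G.input) ∧
      ShiftInv G 0 (run initCode (initState G.input)).reg
        (run initCode (initState G.input)).mem := by
  have h0 := G.input_zero
  constructor
  · simp [initCode, SafeRun, Instr.Safe, initState]
  · constructor
    · rfl
    all_goals simp [initCode, run, Instr.next, initState, h0]
    · ring
    · ring
    · intro r h2 h3 h4 h5 h7 h8 h9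
      simp [*]

theorem shiftBody_spec {X q : ℕ} {s : State} (h : ShiftInv G q s.reg s.mem) :
    SafeRun X shiftBody s ∧
      ShiftInv G (q + 1) (run shiftBody s).reg (run shiftBody s).mem := by
  obtain ⟨hm, h2, h3, h4, h5, h7, h8, h9, ho⟩ := h
  have e : ((q : ℤ) + 1).toNat = q + 1 := by omega
  constructor
  · simp [shiftBody, SafeRun, Instr.Safe, Instr.next, h8, h7]
    omega
  · constructor
    · exact hm
    all_goals simp [shiftBody, run, Instr.next, h2, h3, h4, h5, h7, h8, h9, e, hm]
    · rw [Finset.sum_range_succ]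
      simp [sq]
    · ring
    · intro r h2 h3 h4 h5 h7 h8 h9
      simp only [Function.update_apply]
      split_ifs
      all_goals first | rfl | exact ho r (by simp [*])

theorem ShiftInv.bounded {ℓ X q : ℕ} {s : State} (hX : Large G ℓ X) (hq : q ≤ 2 * (G.n * G.n))
    (h : ShiftInv G q s.reg s.mem) : Bounded X s := by
  obtain ⟨hm, h2, h3, h4, h5, h7, h8, h9, ho⟩ := h
  have hM : ∑ a ∈ Finset.range q, (G.input (a + 1)).natAbs ^ 2 ≤ G.shift :=
    Finset.sum_le_sum_of_subset (Finset.range_mono hq)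
  refine ⟨fun r => ?_, fun a => hm ▸ hX.input a⟩
  have := hX.two
  have := hX.node
  have := hX.head
  have := hX.big
  by_cases hr : r ∈ [2, 3, 4, 5, 7, 8, 9]
  · simp only [List.mem_cons, List.not_mem_nil, or_false] at hr
    rcases hr with rfl | rfl | rfl | rfl | rfl | rfl | rfl
    · rw [h2, Nat.abs_cast]; omega
    · rw [h3, ← Nat.cast_mul, Nat.abs_cast]; omega
    · rw [h4, ← Nat.cast_mul, abs_of_nonneg] <;> omega
    · rw [h5, Nat.abs_cast]; omega
    · rw [h7, abs_one]; omega
    · rw [h8, Nat.abs_cast]; omega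
    · rw [h9, ← Nat.cast_mul, abs_of_nonneg] <;> omega
  · rw [ho r hr, abs_zero]; omega

end shift

/-! ### The second loop: writing the database. -/

section tuples
variable {G : WGraph} {ℓ : ℕ} [NeZero ℓ]

/-- The invariant of the second loop. -/
structure TupleInv (G : WGraph) (ℓ : ℕ) [NeZero ℓ] (q : ℕ) (reg mem : ℕ → ℤ) : Prop where
  low : ∀ a < 2 * (G.n * G.n) + 1, mem a = G.input a
  db : ∀ a < 1 + 4 * q, mem (2 * (G.n * G.n) + 1 + a) = (G.starDB ℓ).input a
  high : ∀ a, 1 + 4 * q ≤ a → mem (2 * (G.n * G.n) + 1 + a) = 0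
  r2 : reg 2 = G.n
  r3 : reg 3 = G.n * G.n
  r4 : reg 4 = 2 * (G.n * G.n) + 1
  r5 : reg 5 = G.shift
  r6 : reg 6 = G.big (ℓ + 1)
  r7 : reg 7 = 1
  r8 : reg 8 = q
  r9 : reg 9 = ℓ * (G.n * G.n) - q
  r10 : reg 10 = ℓ
  other : ∀ r, r ∉ [2, 3, 4, 5, 6, 7, 8, 9, 10] → reg r = 0

/-- The cells behind the matrix are still `0`, so after the header is stored the region of the
database holds a list with no facts written yet. -/
theorem bigCode_spec {X : ℕ} {s : State} (hX : Large G ℓ X)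
    (h : ShiftInv G (2 * (G.n * G.n)) s.reg s.mem) :
    SafeRun X (bigCode ℓ) s ∧
      TupleInv G ℓ 0 (run (bigCode ℓ) s).reg (run (bigCode ℓ) s).mem := by
  obtain ⟨hm, h2, h3, h4, h5, h7, h8, h9, ho⟩ := h
  have hM : s.reg 5 = G.shift := h5
  have e : (2 * ((G.n : ℤ) * G.n) + 1).toNat = 2 * (G.n * G.n) + 1 := by
    rw [← Nat.cast_mul]; omega
  constructor
  · have := hX.card
    have := hX.ell
    simp only [bigCode, SafeRun, Instr.Safe, Instr.next]
    simp [h4, -Nat.cast_mul]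
    omega
  · constructor
    · intro a ha
      simp [bigCode, run, Instr.next, h4, e, hm, ha.ne]
    · intro a ha
      obtain rfl : a = 0 := by omega
      simp [bigCode, run, Instr.next, h4, e, h3, StarDB.input, WGraph.size_starDB]
    · intro a ha
      have : a ≠ 0 := by omega
      simp [bigCode, run, Instr.next, h4, e, hm, this]
      exact G.input_eq_zero (by omega)
    all_goals simp [bigCode, run, Instr.next, h2, h3, h4, hM, h7, WGraph.big]
    · intro r h2 h3 h4 h5 h6 h7 h8 h9 h10
      simp only [Function.update_apply]
      split_ifs
      all_goals first | rfl | exact ho r (by simp [*])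

theorem splitCode_spec {X q : ℕ} {s : State} (h2 : s.reg 2 = G.n) (h8 : s.reg 8 = q)
    (h10 : s.reg 10 = ℓ) (hq : q < ℓ * (G.n * G.n)) :
    SafeRun X splitCode s ∧ (run splitCode s).mem = s.mem ∧
      (run splitCode s).reg 12 = ((q / ℓ : ℕ) : ℤ) ∧ (run splitCode s).reg 13 = ((q % ℓ : ℕ) : ℤ) ∧
      (run splitCode s).reg 14 = ((q / ℓ / G.n : ℕ) : ℤ) ∧
      (run splitCode s).reg 15 = ((q / ℓ % G.n : ℕ) : ℤ) ∧
      ∀ r, r ∉ [12, 13, 14, 15] → (run splitCode s).reg r = s.reg r := by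
  have hn : G.n ≠ 0 := by rintro h; simp [h] at hq
  have hℓ := NeZero.ne ℓ
  refine ⟨?_, rfl, ?_, ?_, ?_, ?_, ?_⟩
  · simp [splitCode, SafeRun, Instr.Safe, Instr.next, h2, h10, hn, hℓ]
  · simp [splitCode, run, Instr.next, h8, h10]
  · simp [splitCode, run, Instr.next, h8, h10, Int.emod_def, mul_comm]
  · simp [splitCode, run, Instr.next, h2, h8, h10]
  · simp [splitCode, run, Instr.next, h2, h8, h10, Int.emod_def, mul_comm]
  · intro r hr
    simp only [List.mem_cons, List.not_mem_nil, or_false, not_or] at hr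
    simp [splitCode, run, Instr.next, hr]

theorem writeCode_spec {X q H : ℕ} {s : State} (h4 : s.reg 4 = H) (h7 : s.reg 7 = 1)
    (h8 : s.reg 8 = q) :
    SafeRun X writeCode s ∧
      (run writeCode s).mem = Function.update (Function.update (Function.update (Function.update
        s.mem (H + (1 + 4 * q)) (s.reg 13)) (H + (1 + 4 * q + 1)) (s.reg 14))
        (H + (1 + 4 * q + 2)) (s.reg 15)) (H + (1 + 4 * q + 3)) (s.reg 16) ∧
      (run writeCode s).reg 8 = q + 1 ∧ (run writeCode s).reg 9 = s.reg 9 - 1 ∧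
      (∀ r, r ∈ [12, 13, 14, 15, 16, 17] → (run writeCode s).reg r = 0) ∧
      ∀ r, r ∉ [8, 9, 12, 13, 14, 15, 16, 17] → (run writeCode s).reg r = s.reg r := by
  have e1 : ((q : ℤ) + q + (q + q) + H + 1).toNat = H + (1 + 4 * q) := by omega
  have e2 : ((q : ℤ) + q + (q + q) + H + 1 + 1).toNat = H + (1 + 4 * q + 1) := by omega
  have e3 : ((q : ℤ) + q + (q + q) + H + 1 + 1 + 1).toNat = H + (1 + 4 * q + 2) := by omega
  have e4 : ((q : ℤ) + q + (q + q) + H + 1 + 1 + 1 + 1).toNat = H + (1 + 4 * q + 3) := by omega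
  refine ⟨?_, ?_, ?_, ?_, ?_, ?_⟩
  · simp [writeCode, SafeRun, Instr.Safe, Instr.next, h4, h7, h8]
    omega
  · simp [writeCode, run, Instr.next, h4, h7, h8, e1, e2, e3, e4]
  · simp [writeCode, run, Instr.next, h7, h8]
  · simp [writeCode, run, Instr.next, h7]
  · intro r hr
    simp only [List.mem_cons, List.not_mem_nil, or_false] at hr
    rcases hr with rfl | rfl | rfl | rfl | rfl | rfl <;> simp [writeCode, run, Instr.next]
  · intro r hr
    simp only [List.mem_cons, List.not_mem_nil, or_false, not_or] at hr
    simp [writeCode, run, Instr.next, hr]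

theorem input_starDB {q : ℕ} (hq : q < ℓ * (G.n * G.n)) :
    (G.starDB ℓ).input (1 + 4 * q) = ((q % ℓ : ℕ) : ℤ) ∧
      (G.starDB ℓ).input (1 + 4 * q + 1) = ((q / ℓ / G.n : ℕ) : ℤ) ∧
      (G.starDB ℓ).input (1 + 4 * q + 2) = ((q / ℓ % G.n : ℕ) : ℤ) ∧
      (G.starDB ℓ).input (1 + 4 * q + 3) = G.cost (ℓ + 1) (q / ℓ) := by
  have hf : (G.starDB ℓ).facts[q]? =
      some ((Fin.ofNat ℓ q, q / ℓ / G.n, q / ℓ % G.n), (G.cost (ℓ + 1) (q / ℓ)).toNat) := by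
    simp [WGraph.starDB, hq]
  have hc : 0 ≤ G.cost (ℓ + 1) (q / ℓ) := WGraph.cost_nonneg'
    ((Nat.div_lt_iff_lt_mul (Nat.pos_of_neZero ℓ)).2 (by rwa [mul_comm]))
  have d : ∀ c < 4, (1 + 4 * q + c - 1) / 4 = q ∧ (1 + 4 * q + c - 1) % 4 = c := by omega
  refine ⟨?_, ?_, ?_, ?_⟩
  · rw [StarDB.input, if_neg (by omega), show (1 + 4 * q - 1) / 4 = q by omega, hf]
    simp
  · rw [StarDB.input, if_neg (by omega), (d 1 (by omega)).1, (d 1 (by omega)).2, hf]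
    simp
  · rw [StarDB.input, if_neg (by omega), (d 2 (by omega)).1, (d 2 (by omega)).2, hf]
    simp
  · rw [StarDB.input, if_neg (by omega), (d 3 (by omega)).1, (d 3 (by omega)).2, hf]
    simpa using hc

theorem input_starDB_eq_zero {a : ℕ} (ha : 1 + 4 * (ℓ * (G.n * G.n)) ≤ a) :
    (G.starDB ℓ).input a = 0 := by
  have : (G.starDB ℓ).facts[(a - 1) / 4]? = none := by
    rw [List.getElem?_eq_none_iff]
    have : (G.starDB ℓ).facts.length = ℓ * (G.n * G.n) := WGraph.size_starDB
    omega
  rw [StarDB.input, if_neg (by omega), this]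

theorem abs_input_starDB_le {X : ℕ} (hX : Large G ℓ X) (a : ℕ) :
    |(G.starDB ℓ).input a| ≤ (X : ℤ) := by
  rcases Nat.eq_zero_or_pos a with rfl | ha
  · rw [StarDB.input, if_pos rfl, WGraph.size_starDB, Nat.abs_cast]
    exact_mod_cast hX.size
  rcases le_or_gt (1 + 4 * (ℓ * (G.n * G.n))) a with h | h
  · rw [input_starDB_eq_zero h, abs_zero]
    omega
  obtain ⟨q, c, hc, rfl⟩ : ∃ q c, c < 4 ∧ a = 1 + 4 * q + c :=
    ⟨(a - 1) / 4, (a - 1) % 4, by omega, by omega⟩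
  have hq : q < ℓ * (G.n * G.n) := by omega
  obtain ⟨h0, h1, h2, h3⟩ := input_starDB hq
  have hp : q / ℓ < G.n * G.n :=
    (Nat.div_lt_iff_lt_mul (Nat.pos_of_neZero ℓ)).2 (by rwa [mul_comm])
  have hn : 0 < G.n := Nat.pos_of_ne_zero fun h => by simp [h] at hp
  have := hX.ell
  have := hX.node
  interval_cases c
  · have := Nat.mod_lt q (Nat.pos_of_neZero ℓ)
    rw [Nat.add_zero, h0, Nat.abs_cast]
    omega
  · have := (Nat.div_lt_iff_lt_mul hn).2 hp
    rw [h1, Nat.abs_cast]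
    omega
  · have := Nat.mod_lt (q / ℓ) hn
    rw [h2, Nat.abs_cast]
    omega
  · have := WGraph.cost_le (k := ℓ + 1) hp
    have := hX.big
    rw [h3, abs_of_nonneg (WGraph.cost_nonneg' hp)]
    omega

theorem tupleBody_spec {X q : ℕ} {s : State} (hq : q < ℓ * (G.n * G.n))
    (h : TupleInv G ℓ q s.reg s.mem) :
    SafeRun X tupleBody s ∧
      TupleInv G ℓ (q + 1) (run tupleBody s).reg (run tupleBody s).mem := by
  obtain ⟨i0, i1, i2, i3⟩ := input_starDB hq
  have hp : q / ℓ < G.n * G.n :=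
    (Nat.div_lt_iff_lt_mul (Nat.pos_of_neZero ℓ)).2 (by rwa [mul_comm])
  obtain ⟨sa, ma, a12, a13, a14, a15, oa⟩ := splitCode_spec (X := X) h.r2 h.r8 h.r10 hq
  rw [tupleBody, safeRun_append, safeRun_append, run_append, run_append]
  set s₁ := run splitCode s
  obtain ⟨sb, mb, b16, ob⟩ := costCode_spec (X := X) (s := s₁) (G := G) (k := ℓ + 1)
    (by rw [oa 5 (by simp), h.r5]) (by rw [oa 6 (by simp), h.r6]) (by rw [oa 7 (by simp), h.r7])
    a12 hp (by rw [ma]; exact h.low)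
  set s₂ := run costCode s₁
  have keep : ∀ r, r ∉ [12, 13, 14, 15, 16, 17] → s₂.reg r = s.reg r := by
    intro r hr
    simp only [List.mem_cons, List.not_mem_nil, or_false, not_or] at hr
    rw [ob r (by omega) (by omega), oa r (by simp; omega)]
  obtain ⟨sc, mc, c8, c9, cz, oc⟩ := writeCode_spec (X := X) (s := s₂) (q := q)
    (H := 2 * (G.n * G.n) + 1) (by rw [keep 4 (by simp), h.r4]; push_cast; rfl)
    (by rw [keep 7 (by simp), h.r7]) (by rw [keep 8 (by simp), h.r8])
  rw [mb, ma, ob 13 (by simp) (by simp), ob 14 (by simp) (by simp), ob 15 (by simp) (by simp),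
    a13, a14, a15, b16, ← i0, ← i1, ← i2, ← i3] at mc
  refine ⟨⟨sa, sb, sc⟩, ?_⟩
  set s₃ := run writeCode s₂
  have keep' : ∀ r, r ∉ [8, 9, 12, 13, 14, 15, 16, 17] → s₃.reg r = s.reg r := by
    intro r hr
    rw [oc r hr, keep r (by simp at hr ⊢; omega)]
  constructor
  · intro a ha
    rw [mc]
    simp only [Function.update_apply]
    rw [if_neg (by omega), if_neg (by omega), if_neg (by omega), if_neg (by omega), h.low a ha]
  · intro a ha
    rw [mc]
    simp only [Function.update_apply, Nat.add_left_cancel_iff (n := 2 * (G.n * G.n) + 1)]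
    split_ifs
    all_goals first | (congr 1; omega) | exact h.db a (by omega)
  · intro a ha
    rw [mc]
    simp only [Function.update_apply]
    rw [if_neg (by omega), if_neg (by omega), if_neg (by omega), if_neg (by omega),
      h.high a (by omega)]
  · rw [keep' 2 (by simp), h.r2]
  · rw [keep' 3 (by simp), h.r3]
  · rw [keep' 4 (by simp), h.r4]
  · rw [keep' 5 (by simp), h.r5]
  · rw [keep' 6 (by simp), h.r6]
  · rw [keep' 7 (by simp), h.r7]
  · rw [c8]; push_cast; rfl
  · rw [c9, keep 9 (by simp), h.r9]; push_cast; ring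
  · rw [keep' 10 (by simp), h.r10]
  · intro r hr
    by_cases hr' : r ∈ [12, 13, 14, 15, 16, 17]
    · exact cz r hr'
    · rw [keep' r (by simp at hr hr' ⊢; omega), h.other r hr]

theorem TupleInv.bounded {X q : ℕ} {s : State} (hX : Large G ℓ X) (hq : q ≤ ℓ * (G.n * G.n))
    (h : TupleInv G ℓ q s.reg s.mem) : Bounded X s := by
  have := hX.two
  have := hX.ell
  have := hX.node
  have := hX.head
  have := hX.big
  have := hX.size
  constructor
  · intro r
    by_cases hr : r ∈ [2, 3, 4, 5, 6, 7, 8, 9, 10]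
    · simp only [List.mem_cons, List.not_mem_nil, or_false] at hr
      rcases hr with rfl | rfl | rfl | rfl | rfl | rfl | rfl | rfl | rfl
      · rw [h.r2, Nat.abs_cast]; omega
      · rw [h.r3, ← Nat.cast_mul, Nat.abs_cast]; omega
      · rw [h.r4, ← Nat.cast_mul, abs_of_nonneg] <;> omega
      · rw [h.r5, Nat.abs_cast]; omega
      · rw [h.r6, Nat.abs_cast]; omega
      · rw [h.r7, abs_one]; omega
      · rw [h.r8, Nat.abs_cast]; omega
      · rw [h.r9, ← Nat.cast_mul, ← Nat.cast_mul, abs_of_nonneg] <;> omega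
      · rw [h.r10, Nat.abs_cast]; omega
    · rw [h.other r hr, abs_zero]; omega
  · intro a
    rcases lt_or_ge a (2 * (G.n * G.n) + 1) with ha | ha
    · rw [h.low a ha]
      exact hX.input a
    · obtain ⟨a, rfl⟩ := Nat.exists_eq_add_of_le ha
      rcases lt_or_ge a (1 + 4 * q) with ha | ha
      · rw [h.db a ha]
        exact abs_input_starDB_le hX a
      · rw [h.high a ha, abs_zero]
        omega

end tuples
end StarTropical

namespace StarTropical

/-! ### The third loop: the minimum over the result of the query. -/

section results
variable {G : WGraph} {ℓ N b : ℕ} {x : ℕ → Fin ℓ → ℕ} {v : ℕ → ℕ}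

/-- The memory holds the graph and a list of `N` annotated tuples of nodes, where the `j`-th tuple
is `x j` and has annotation `v j`. -/
structure Results (G : WGraph) (ℓ N b : ℕ) (x : ℕ → Fin ℓ → ℕ) (v : ℕ → ℕ) (mem : ℕ → ℤ) :
    Prop where
  low : ∀ a < 2 * (G.n * G.n) + 1, mem a = G.input a
  lt : ∀ j < N, ∀ i, x j i < G.n
  node : ∀ j < N, ∀ i : Fin ℓ, mem (2 * (G.n * G.n) + 1 + (b + j * (ℓ + 1) + i)) = x j i
  val : ∀ j < N, mem (2 * (G.n * G.n) + 1 + (b + j * (ℓ + 1) + ℓ)) = v j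

/-- The minimum weight of the tuples that consist of the nodes `x` and a further node, where `w` is
the annotation of `x`. -/
noncomputable def resultCost (G : WGraph) {ℓ : ℕ} (x : Fin ℓ → ℕ) (w : ℕ) : ℤ :=
  w + ∑ p ∈ pairs ℓ, G.cost (ℓ + 1) (x p.1 * G.n + x p.2)

theorem resultCost_nonneg {x : Fin ℓ → ℕ} {w : ℕ} (hx : ∀ i, x i < G.n) :
    0 ≤ resultCost G x w :=
  add_nonneg (Nat.cast_nonneg _)
    (Finset.sum_nonneg fun p _ => WGraph.cost_nonneg (hx p.1) (hx p.2))

theorem indexCode_spec {X : ℕ} {s : State} {A : ℕ} {x : Fin ℓ → ℕ} (hX : Large G ℓ X)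
    (h2 : s.reg 2 = G.n) (h21 : s.reg 21 = A) (hxm : ∀ i : Fin ℓ, s.mem (A + i) = x i)
    (p : Fin ℓ × Fin ℓ) :
    SafeRun X (indexCode p) s ∧ (run (indexCode p) s).mem = s.mem ∧
      (run (indexCode p) s).reg 12 = ((x p.1 * G.n + x p.2 : ℕ) : ℤ) ∧
      ∀ r, r ≠ 12 → r ≠ 14 → (run (indexCode p) s).reg r = s.reg r := by
  have e : ∀ i : Fin ℓ, (((i : ℕ) : ℤ) + A).toNat = A + i := fun i => by omega
  have hlt : ∀ i : Fin ℓ, (i : ℕ) ≤ X := fun i => i.2.le.trans hX.ell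
  refine ⟨?_, rfl, ?_, ?_⟩
  · simp [indexCode, SafeRun, Instr.Safe, Instr.next, h21, hlt]
    omega
  · simp [indexCode, run, Instr.next, h2, h21, e, hxm]
  · intro r h h'
    simp [indexCode, run, Instr.next, h, h']

theorem pairCode_spec {X : ℕ} {s : State} {A : ℕ} {x : Fin ℓ → ℕ} (hX : Large G ℓ X)
    (h2 : s.reg 2 = G.n) (h5 : s.reg 5 = G.shift) (h6 : s.reg 6 = G.big (ℓ + 1))
    (h7 : s.reg 7 = 1) (h21 : s.reg 21 = A) (hx : ∀ i, x i < G.n)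
    (hm : ∀ a < 2 * (G.n * G.n) + 1, s.mem a = G.input a) (hxm : ∀ i : Fin ℓ, s.mem (A + i) = x i)
    (p : Fin ℓ × Fin ℓ) :
    SafeRun X (pairCode p) s ∧ (run (pairCode p) s).mem = s.mem ∧
      (run (pairCode p) s).reg 13 = s.reg 13 + G.cost (ℓ + 1) (x p.1 * G.n + x p.2) ∧
      ∀ r, r ∉ [12, 13, 14, 16, 17] → (run (pairCode p) s).reg r = s.reg r := by
  obtain ⟨sa, ma, a12, oa⟩ := indexCode_spec hX h2 h21 hxm p
  rw [pairCode, safeRun_append, safeRun_append, run_append, run_append]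
  generalize run (indexCode p) s = s₁ at *
  obtain ⟨sb, mb, b16, ob⟩ := costCode_spec (X := X) (s := s₁) (G := G)
    (k := ℓ + 1) (by rw [oa 5 (by simp) (by simp), h5]) (by rw [oa 6 (by simp) (by simp), h6])
    (by rw [oa 7 (by simp) (by simp), h7]) a12 (WGraph.pos_lt (hx _) (hx _)) (by rwa [ma])
  generalize run costCode s₁ = s₂ at *
  refine ⟨⟨sa, sb, trivial, trivial⟩, mb.trans ma, ?_, ?_⟩
  · simp [run, Instr.next, b16, ob 13, oa 13]
  · intro r hr
    simp only [List.mem_cons, List.not_mem_nil, or_false, not_or] at hr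
    simp only [run, Instr.next]
    rw [Function.update_of_ne (by omega), ob r (by omega) (by omega), oa r (by omega) (by omega)]

theorem pairCodes_spec {X : ℕ} {s : State} {A : ℕ} {x : Fin ℓ → ℕ} (hX : Large G ℓ X)
    (h2 : s.reg 2 = G.n) (h5 : s.reg 5 = G.shift) (h6 : s.reg 6 = G.big (ℓ + 1))
    (h7 : s.reg 7 = 1) (h21 : s.reg 21 = A) (hx : ∀ i, x i < G.n)
    (hm : ∀ a < 2 * (G.n * G.n) + 1, s.mem a = G.input a) (hxm : ∀ i : Fin ℓ, s.mem (A + i) = x i)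
    (ps : List (Fin ℓ × Fin ℓ)) :
    SafeRun X (ps.flatMap pairCode) s ∧ (run (ps.flatMap pairCode) s).mem = s.mem ∧
      (run (ps.flatMap pairCode) s).reg 13 =
        s.reg 13 + (ps.map fun p => G.cost (ℓ + 1) (x p.1 * G.n + x p.2)).sum ∧
      ∀ r, r ∉ [12, 13, 14, 16, 17] → (run (ps.flatMap pairCode) s).reg r = s.reg r := by
  induction ps generalizing s with
  | nil => simp [SafeRun, run]
  | cons p ps ih =>
    obtain ⟨sa, ma, a13, oa⟩ := pairCode_spec hX h2 h5 h6 h7 h21 hx hm hxm p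
    rw [List.flatMap_cons, safeRun_append, run_append]
    obtain ⟨sb, mb, b13, ob⟩ := ih (s := run (pairCode p) s) (by rw [oa 2 (by simp), h2])
      (by rw [oa 5 (by simp), h5]) (by rw [oa 6 (by simp), h6]) (by rw [oa 7 (by simp), h7])
      (by rw [oa 21 (by simp), h21]) (by rwa [ma]) (by rwa [ma])
    refine ⟨⟨sa, sb⟩, mb.trans ma, ?_, fun r hr => (ob r hr).trans (oa r hr)⟩
    rw [b13, a13, List.map_cons, List.sum_cons, add_assoc]

/-- Since `|d| < d * d + 1` and integer division rounds down for a positive divisor, the quotient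
detects the sign of `d` without a jump. -/
theorem ediv_sq_add_one (d : ℤ) : d / (d * d + 1) = if d < 0 then -1 else 0 := by
  split_ifs with h
  · rw [← neg_neg (d / _), ← Int.ediv_neg]
    have h1 : d = -1 * (d * d + 1) + (d * d + 1 + d) := by ring
    rw [Int.ediv_neg, neg_neg]
    -- Quotient `-1` leaves the remainder `d * d + 1 + d`, which is non-negative and, for `d < 0`,
    -- smaller than the divisor.
    refine (Int.ediv_emod_unique (r := d * d + 1 + d) (by nlinarith)).2 ⟨by ring, ?_, by omega⟩ |>.1
    nlinarith
  · exact Int.ediv_eq_zero_of_lt (by omega) (by nlinarith)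

/-- The invariant of the third loop. -/
structure ResultInv (G : WGraph) (ℓ N b : ℕ) (x : ℕ → Fin ℓ → ℕ) (v : ℕ → ℕ) (X : ℕ) (j : ℕ)
    (reg mem : ℕ → ℤ) : Prop where
  results : Results G ℓ N b x v mem
  mem_le : ∀ a, |mem a| ≤ (X : ℤ)
  r2 : reg 2 = G.n
  r5 : reg 5 = G.shift
  r6 : reg 6 = G.big (ℓ + 1)
  r7 : reg 7 = 1
  r10 : reg 10 = ℓ
  nonneg : 0 ≤ reg 11
  le_big : reg 11 ≤ G.big (ℓ + 1)
  le_cost : ∀ i < j, reg 11 ≤ resultCost G (x i) (v i)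
  eq_or : reg 11 = G.big (ℓ + 1) ∨ ∃ i < j, reg 11 = resultCost G (x i) (v i)
  r20 : reg 20 = N - j
  r21 : reg 21 = (2 * (G.n * G.n) + 1 + (b + j * (ℓ + 1)) : ℕ)
  other : ∀ r, r ∉ [2, 5, 6, 7, 10, 11, 20, 21] → |reg r| ≤ (X : ℤ)

theorem minCode_spec {X A : ℕ} {s : State} (h7 : s.reg 7 = 1) (h10 : s.reg 10 = ℓ)
    (h21 : s.reg 21 = A) :
    SafeRun X minCode s ∧ (run minCode s).mem = s.mem ∧
      (run minCode s).reg 11 = min (s.reg 11) (s.reg 13) ∧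
      (run minCode s).reg 20 = s.reg 20 - 1 ∧
      (run minCode s).reg 21 = ((A + (ℓ + 1) : ℕ) : ℤ) ∧
      (∀ r, r ∈ [12, 13, 14, 16, 17] → (run minCode s).reg r = 0) ∧
      ∀ r, r ∉ [11, 12, 13, 14, 16, 17, 20, 21] → (run minCode s).reg r = s.reg r := by
  have hne : (s.reg 11 - s.reg 13) * (s.reg 11 - s.reg 13) + 1 ≠ 0 := by nlinarith
  refine ⟨?_, rfl, ?_, ?_, ?_, ?_, ?_⟩
  · simpa [minCode, SafeRun, Instr.Safe, Instr.next, h7] using hne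
  · simp [minCode, run, Instr.next, h7, ediv_sq_add_one]
    split_ifs
    · rw [min_eq_left (by omega)]; ring
    · rw [min_eq_right (by omega)]; ring
  · simp [minCode, run, Instr.next, h7]
  · simp [minCode, run, Instr.next, h7, h10, h21]
    ring
  · intro r hr
    simp only [List.mem_cons, List.not_mem_nil, or_false] at hr
    rcases hr with rfl | rfl | rfl | rfl | rfl <;> simp [minCode, run, Instr.next]
  · intro r hr
    simp only [List.mem_cons, List.not_mem_nil, or_false, not_or] at hr
    simp [minCode, run, Instr.next, hr]

theorem annotationCode_spec {X A : ℕ} {s : State} (hX : Large G ℓ X) (h21 : s.reg 21 = A) :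
    SafeRun X (annotationCode ℓ) s ∧ (run (annotationCode ℓ) s).mem = s.mem ∧
      (run (annotationCode ℓ) s).reg 13 = s.mem (A + ℓ) ∧
      ∀ r, r ≠ 12 → r ≠ 13 → (run (annotationCode ℓ) s).reg r = s.reg r := by
  have e : ((ℓ : ℤ) + A).toNat = A + ℓ := by omega
  have := hX.ell
  refine ⟨?_, rfl, ?_, ?_⟩
  · simp [annotationCode, SafeRun, Instr.Safe, Instr.next, h21]
    omega
  · simp [annotationCode, run, Instr.next, h21, e]
  · intro r h h'
    simp [annotationCode, run, Instr.next, h, h']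

theorem resultBody_spec {X Y j : ℕ} {s : State} (hX : Large G ℓ X) (hj : j < N)
    (h : ResultInv G ℓ N b x v Y j s.reg s.mem) :
    SafeRun X (resultBody ℓ) s ∧
      ResultInv G ℓ N b x v Y (j + 1) (run (resultBody ℓ) s).reg (run (resultBody ℓ) s).mem := by
  have hr := h.results
  obtain ⟨sa, ma, a13, oa⟩ := annotationCode_spec hX h.r21
  rw [resultBody, safeRun_append, safeRun_append, run_append, run_append]
  set s₁ := run (annotationCode ℓ) s
  obtain ⟨sb, mb, b13, ob⟩ := pairCodes_spec (s := s₁) (x := x j) hX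
    (by rw [oa 2 (by simp) (by simp), h.r2]) (by rw [oa 5 (by simp) (by simp), h.r5])
    (by rw [oa 6 (by simp) (by simp), h.r6]) (by rw [oa 7 (by simp) (by simp), h.r7])
    (by rw [oa 21 (by simp) (by simp), h.r21]) (hr.lt j hj) (by rw [ma]; exact hr.low)
    (fun i => by rw [ma, add_assoc]; exact hr.node j hj i) (pairs ℓ).toList
  set s₂ := run ((pairs ℓ).toList.flatMap pairCode) s₁
  have keep : ∀ r, r ∉ [12, 13, 14, 16, 17] → s₂.reg r = s.reg r := by
    intro r hr
    rw [ob r hr]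
    simp only [List.mem_cons, List.not_mem_nil, or_false, not_or] at hr
    rw [oa r (by omega) (by omega)]
  have hcost : s₂.reg 13 = resultCost G (x j) (v j) := by
    rw [b13, a13, add_assoc, hr.val j hj, Finset.sum_map_toList, resultCost]
  obtain ⟨sc, mc, c11, c20, c21, cz, oc⟩ := minCode_spec (X := X) (s := s₂) (ℓ := ℓ)
    (by rw [keep 7 (by simp), h.r7]) (by rw [keep 10 (by simp), h.r10])
    (by rw [keep 21 (by simp), h.r21])
  rw [keep 11 (by simp), hcost] at c11
  refine ⟨⟨sa, sb, sc⟩, ?_⟩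
  set s₃ := run minCode s₂
  have keep' : ∀ r, r ∉ [11, 12, 13, 14, 16, 17, 20, 21] → s₃.reg r = s.reg r := by
    intro r hr
    rw [oc r hr, keep r (by simp at hr ⊢; omega)]
  have hmem : s₃.mem = s.mem := by rw [mc, mb, ma]
  constructor
  · rw [hmem]; exact hr
  · rw [hmem]; exact h.mem_le
  · rw [keep' 2 (by simp), h.r2]
  · rw [keep' 5 (by simp), h.r5]
  · rw [keep' 6 (by simp), h.r6]
  · rw [keep' 7 (by simp), h.r7]
  · rw [keep' 10 (by simp), h.r10]
  · rw [c11]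
    exact le_min h.nonneg (resultCost_nonneg (hr.lt j hj))
  · rw [c11]
    exact (min_le_left _ _).trans h.le_big
  · intro i hi
    rw [c11]
    rcases Nat.lt_succ_iff_lt_or_eq.1 hi with hi | rfl
    · exact (min_le_left _ _).trans (h.le_cost i hi)
    · exact min_le_right _ _
  · rw [c11]
    rcases min_choice (s.reg 11) (resultCost G (x j) (v j)) with hmin | hmin <;> rw [hmin]
    · exact h.eq_or.imp id fun ⟨i, hi, he⟩ => ⟨i, by omega, he⟩
    · exact .inr ⟨j, by omega, rfl⟩
  · rw [c20, keep 20 (by simp), h.r20]; push_cast; ring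
  · rw [c21]; congr 1; ring
  · intro r hr
    by_cases hr' : r ∈ [12, 13, 14, 16, 17]
    · rw [cz r hr', abs_zero]; omega
    · rw [keep' r (by simp at hr hr' ⊢; omega)]
      exact h.other r hr

/-- The factor `3` comes from the address in register `21`: offset of the database, start of the
list and position in the list are each at most `X`. -/
theorem ResultInv.bounded {X j : ℕ} {s : State} (hX : Large G ℓ X) (hj : j ≤ N)
    (hN : N ≤ G.n ^ ℓ) (hb : b ≤ X)
    (h : ResultInv G ℓ N b x v X j s.reg s.mem) : Bounded (3 * X) s := by
  have := hX.two
  have := hX.ell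
  have := hX.node
  have := hX.head
  have := hX.big
  have h1 : j * (ℓ + 1) ≤ X := (Nat.mul_le_mul_right _ (hj.trans hN)).trans hX.out
  have h2 : N ≤ X := hN.trans ((Nat.le_mul_of_pos_right _ (by omega)).trans hX.out)
  refine ⟨fun r => ?_, fun a => (h.mem_le a).trans (by omega)⟩
  by_cases hr : r ∈ [2, 5, 6, 7, 10, 11, 20, 21]
  · simp only [List.mem_cons, List.not_mem_nil, or_false] at hr
    rcases hr with rfl | rfl | rfl | rfl | rfl | rfl | rfl | rfl
    · rw [h.r2, Nat.abs_cast]; omega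
    · rw [h.r5, Nat.abs_cast]; omega
    · rw [h.r6, Nat.abs_cast]; omega
    · rw [h.r7, abs_one]; omega
    · rw [h.r10, Nat.abs_cast]; omega
    · have := h.le_big
      rw [abs_of_nonneg h.nonneg]; omega
    · rw [h.r20, abs_of_nonneg] <;> omega
    · rw [h.r21, Nat.abs_cast]; omega
  · exact (h.other r hr).trans (by omega)

theorem answerCode_spec {X : ℕ} {s : State} (hX : Large G ℓ X) (h5 : s.reg 5 = G.shift)
    (h6 : s.reg 6 = G.big (ℓ + 1)) (h7 : s.reg 7 = 1) :
    SafeRun X (answerCode ℓ) s ∧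
      (run (answerCode ℓ) s).reg 0 = (if s.reg 11 < G.big (ℓ + 1) then 1 else 0) ∧
      (run (answerCode ℓ) s).reg 1 = s.reg 11 - (pairs (ℓ + 1)).card * G.shift := by
  have hne : (s.reg 11 - G.big (ℓ + 1)) * (s.reg 11 - G.big (ℓ + 1)) + 1 ≠ 0 := by nlinarith
  have := hX.card
  refine ⟨?_, ?_, ?_⟩
  · simp [answerCode, SafeRun, Instr.Safe, Instr.next, h6, h7, hne]
    omega
  · simp [answerCode, run, Instr.next, h6, h7, ediv_sq_add_one]
    split_ifs <;> rfl
  · simp [answerCode, run, Instr.next, h5]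

end results
end StarTropical

namespace StarTropical

/-! ## The program for minimum-weight cliques -/

def shiftProgram : Program := initCode ++ loopCode initCode.length 9 shiftBody

def bigProgram (ℓ : ℕ) : Program := shiftProgram ++ bigCode ℓ

/-- Writes the database of a weighted graph to the memory. -/
def dbProgram (ℓ : ℕ) : Program :=
  bigProgram ℓ ++ loopCode (bigProgram ℓ).length 9 tupleBody

def queryProgram (ℓ : ℕ) (P : Program) : Program :=
  dbProgram ℓ ++ relocCode (dbProgram ℓ).length P.length P

def resultProgram (ℓ : ℕ) (P : Program) : Program :=
  queryProgram ℓ P ++ ([.const 12 0] ++ resultCode)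

noncomputable def minProgram (ℓ : ℕ) (P : Program) : Program :=
  resultProgram ℓ P ++ loopCode (resultProgram ℓ P).length 20 (resultBody ℓ)

/-- Computes the minimum weight of a clique with `ℓ + 1` nodes, given a program `P` that evaluates
the star query with `ℓ` relations. -/
noncomputable def cliqueProgram (ℓ : ℕ) (P : Program) : Program :=
  minProgram ℓ P ++ answerCode ℓ

/-- The number of instructions that are executed outside of the evaluation of the query. -/
noncomputable def cliqueOverhead (ℓ n : ℕ) : ℕ :=
  initCode.length + (2 + 2 * (n * n) * (shiftBody.length + 1)) + (bigCode ℓ).length +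
    (2 + ℓ * (n * n) * (tupleBody.length + 1)) + 1 + resultCode.length +
    (2 + n ^ ℓ * ((resultBody ℓ).length + 1)) + (answerCode ℓ).length

theorem Large.mono {G : WGraph} {ℓ X Y : ℕ} (h : Large G ℓ X) (hXY : X ≤ Y) : Large G ℓ Y where
  two := h.two.trans hXY
  ell := h.ell.trans hXY
  card := h.card.trans hXY
  node := h.node.trans hXY
  head := h.head.trans hXY
  size := h.size.trans hXY
  big := h.big.trans hXY
  out := h.out.trans hXY
  input a := (h.input a).trans (by exact_mod_cast hXY)

variable {G : WGraph} {ℓ : ℕ}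

theorem runs_dbProgram [NeZero ℓ] {Q : Program} {X W : ℕ} (hX : Large G ℓ X)
    (hQ : CodeAt Q 0 (dbProgram ℓ)) (hW : ∀ m ≤ (dbProgram ℓ).length, X ^ 2 ^ m ≤ W) :
    ∃ s, TupleInv G ℓ (ℓ * (G.n * G.n)) s.reg s.mem ∧ s.pc = (dbProgram ℓ).length ∧
      Runs Q W (initCode.length + (2 + 2 * (G.n * G.n) * (shiftBody.length + 1)) +
        (bigCode ℓ).length + (2 + ℓ * (G.n * G.n) * (tupleBody.length + 1)))
        (initState G.input) s := by
  obtain ⟨hQ3, hc4⟩ := codeAt_append.1 (show CodeAt Q 0 (bigProgram ℓ ++ _) from hQ)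
  obtain ⟨hQ2, hc3⟩ := codeAt_append.1 (show CodeAt Q 0 (shiftProgram ++ _) from hQ3)
  obtain ⟨hc1, hc2⟩ := codeAt_append.1 (show CodeAt Q 0 (initCode ++ _) from hQ2)
  rw [zero_add] at hc2 hc3 hc4
  have l1 : shiftProgram.length = initCode.length + (shiftBody.length + 2) := by
    rw [shiftProgram, List.length_append, length_loopCode]
  have l2 : (bigProgram ℓ).length = shiftProgram.length + (bigCode ℓ).length := by
    rw [bigProgram, List.length_append]
  have l3 : (dbProgram ℓ).length = (bigProgram ℓ).length + (tupleBody.length + 2) := by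
    rw [dbProgram, List.length_append, length_loopCode]
  have h2 := hX.two
  have hi := initCode_spec (G := G) (X := X - 1)
  rw [Nat.sub_add_cancel (by omega)] at hi
  obtain ⟨r1, p1⟩ := runs_straight (P := Q) h2 (hW _ (by omega)) hc1
    ⟨fun r => by simp [initState], hX.input⟩ hi.1
  obtain ⟨s2, i2, p2, r2⟩ := runs_loop (P := Q) (I := ShiftInv G) (N := 2 * (G.n * G.n)) h2
    (hW _ (by omega)) (by rw [p1]; simp [initState]) hc2 hi.2
    (fun i s hi h => ⟨h.bounded hX hi, by rw [h.r9]; push_cast; rfl⟩)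
    (fun i s _ h => shiftBody_spec h)
  rw [← List.length_append] at p2
  obtain ⟨hs3, i3⟩ := bigCode_spec hX i2
  obtain ⟨r3, p3⟩ := runs_straight (P := Q) h2 (hW _ (by omega)) (by rw [p2]; exact hc3)
    (i2.bounded hX le_rfl) hs3
  obtain ⟨s4, i4, p4, r4⟩ := runs_loop (P := Q) (I := TupleInv G ℓ) (N := ℓ * (G.n * G.n)) h2
    (hW _ (by omega)) (by rw [p3, p2, l2, shiftProgram]) hc4 i3
    (fun i s hi h => ⟨h.bounded hX hi, by rw [h.r9]; push_cast; rfl⟩)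
    (fun i s hi h => tupleBody_spec hi h)
  exact ⟨s4, i4, by rw [p4, length_loopCode, l3], ((r1.trans r2).trans r3).trans r4⟩

/-- After the second loop, the registers from `20` on are `0` and the memory behind the graph is
exactly the encoded database, so the relocated `P` starts in its initial state. It changes neither
the graph nor the low registers other than `12`. -/
theorem runs_resultProgram [NeZero ℓ] {P Q : Program} {X W W' t N b : ℕ} {s₀ s : State}
    {x : ℕ → Fin ℓ → ℕ} {v : ℕ → ℕ}
    (hX : Large G ℓ X) (hQ : CodeAt Q 0 (resultProgram ℓ P))
    (hWX : W ≤ X) (hXW' : X + (2 * (G.n * G.n) + 1) ≤ W')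
    (hW' : ∀ m ≤ (resultProgram ℓ P).length, X ^ 2 ^ m ≤ W')
    (h0 : TupleInv G ℓ (ℓ * (G.n * G.n)) s₀.reg s₀.mem) (hpc : s₀.pc = (dbProgram ℓ).length)
    (hP : HaltsIn P W t (initState (G.starDB ℓ).input) s)
    (hN : s.reg 0 = N) (hb : s.reg 1 = b) (hlt : ∀ j < N, ∀ i, x j i < G.n)
    (hx : ∀ j < N, ∀ i : Fin ℓ, s.mem (b + j * (ℓ + 1) + i) = x j i)
    (hv : ∀ j < N, s.mem (b + j * (ℓ + 1) + ℓ) = v j) :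
    b ≤ X ∧ ∃ s', ResultInv G ℓ N b x v X 0 s'.reg s'.mem ∧ s'.pc = (resultProgram ℓ P).length ∧
      Runs Q W' (2 * t + 1 + resultCode.length) s₀ s' := by
  obtain ⟨hQ1, hc2⟩ := codeAt_append.1 (show CodeAt Q 0 (queryProgram ℓ P ++ _) from hQ)
  obtain ⟨-, hc1⟩ := codeAt_append.1 (show CodeAt Q 0 (dbProgram ℓ ++ _) from hQ1)
  rw [zero_add] at hc1 hc2
  obtain ⟨hcc, hcr⟩ := codeAt_append.1 hc2
  have l1 : (queryProgram ℓ P).length = (dbProgram ℓ).length + 2 * P.length := by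
    rw [queryProgram, List.length_append, length_relocCode]
  have l2 : (resultProgram ℓ P).length = (queryProgram ℓ P).length + (1 + resultCode.length) := by
    simp only [resultProgram, List.length_append, List.length_singleton]
  have hsim : Simulates (dbProgram ℓ).length P.length (2 * (G.n * G.n) + 1) s₀.reg s₀.mem
      (initState (G.starDB ℓ).input) s₀ := by
    refine ⟨by simpa [initState] using hpc, fun r => ?_, fun a => ?_, fun _ _ _ => rfl,
      fun _ _ => rfl⟩
    · exact h0.other _ (by simp)
    · rcases lt_or_ge a (1 + 4 * (ℓ * (G.n * G.n))) with ha | ha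
      · exact h0.db a ha
      · rw [h0.high a ha]
        exact (input_starDB_eq_zero ha).symm
  have hb0 := h0.bounded hX le_rfl
  obtain ⟨hbs, s₁, h1, hpc1, r1⟩ := hsim.runs (W' := W') (Y := X) hc1
    (by rw [h0.r4]; push_cast; rfl) hWX hXW' ⟨fun r => by simp [initState], abs_input_starDB_le hX⟩ hP
  -- The list address was the content of a register of `P`, so it is bounded like all others.
  have hbX : b ≤ X := by
    have := hbs.1 1
    rw [hb, Nat.abs_cast] at this
    exact_mod_cast this
  refine ⟨hbX, ?_⟩
  -- `Simulates` does not control the scratch register `12`, which may hold a shifted address;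
  -- clearing it restores the bound `X`.
  set s₂ : State := ⟨s₁.pc + 1, Function.update s₁.reg 12 0, s₁.mem⟩ with hs₂
  have r2 : Runs Q W' 1 s₁ s₂ := by
    refine Runs.single (i := .const 12 0) ?_ (State.setReg_eq (by simp))
    rw [hpc1, ← l1]
    exact hcc.head
  have hlow : ∀ r < 20, r ≠ 12 → s₂.reg r = s₀.reg r := fun r hr hr' =>
    (Function.update_of_ne hr' _ _).trans (h1.regLow r hr hr')
  have hhigh : ∀ r, s₂.reg (r + 20) = s.reg r := fun r =>
    (Function.update_of_ne (by omega : r + 20 ≠ 12) 0 s₁.reg).trans (h1.reg r)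
  have hb2 : Bounded X s₂ := by
    refine ⟨fun r => ?_, fun a => ?_⟩
    · rcases eq_or_ne r 12 with rfl | hr
      · simp [hs₂]
      · rcases lt_or_ge r 20 with hr' | hr'
        · rw [hlow r hr' hr]
          exact hb0.1 r
        · obtain ⟨r, rfl⟩ := Nat.exists_eq_add_of_le' hr'
          rw [hhigh]
          exact hbs.1 r
    · rcases lt_or_ge a (2 * (G.n * G.n) + 1) with ha | ha
      · rw [show s₂.mem a = s₀.mem a from h1.memLow a ha]
        exact hb0.2 a
      · obtain ⟨a, rfl⟩ := Nat.exists_eq_add_of_le ha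
        rw [show s₂.mem _ = s.mem a from h1.mem a]
        exact hbs.2 a
  have hp2 : s₂.pc = (queryProgram ℓ P).length + 1 := by
    rw [l1]; exact congrArg (· + 1) hpc1
  obtain ⟨r3, p3⟩ := runs_straight (P := Q) (s := s₂) (code := resultCode) hX.two
    (hW' _ (by omega)) (by rw [hp2]; exact hcr) hb2
    (by simp [resultCode, SafeRun, Instr.Safe])
  have hreg : ∀ r, r ≠ 11 → r ≠ 21 → (run resultCode s₂).reg r = s₂.reg r := by
    intro r h h'
    simp [resultCode, run, Instr.next, h, h']
  have e11 : (run resultCode s₂).reg 11 = G.big (ℓ + 1) := by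
    simp [resultCode, run, Instr.next, hlow, h0.r6, h0.other]
  have e21 : (run resultCode s₂).reg 21 = (b : ℤ) + (2 * (G.n * G.n) + 1) := by
    have : s₂.reg 21 = b := by rw [← hb]; exact hhigh 1
    simp [resultCode, run, Instr.next, hlow, h0.r4, this]
  have hmem : (run resultCode s₂).mem = s₁.mem := rfl
  refine ⟨run resultCode s₂, ⟨⟨?_, hlt, ?_, ?_⟩, hb2.2,
      ?_, ?_, ?_, ?_, ?_, ?_, ?_, ?_, ?_, ?_, ?_, ?_⟩,
    by rw [p3, hp2, l2]; omega, (r1.trans r2).trans r3⟩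
  · intro a ha
    rw [hmem, h1.memLow a ha, h0.low a ha]
  · intro j hj i
    rw [hmem, h1.mem, hx j hj]
  · intro j hj
    rw [hmem, h1.mem, hv j hj]
  · rw [hreg 2 (by simp) (by simp), hlow 2 (by simp) (by simp), h0.r2]
  · rw [hreg 5 (by simp) (by simp), hlow 5 (by simp) (by simp), h0.r5]
  · rw [hreg 6 (by simp) (by simp), hlow 6 (by simp) (by simp), h0.r6]
  · rw [hreg 7 (by simp) (by simp), hlow 7 (by simp) (by simp), h0.r7]
  · rw [hreg 10 (by simp) (by simp), hlow 10 (by simp) (by simp), h0.r10]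
  · rw [e11]; exact Nat.cast_nonneg _
  · rw [e11]
  · intro i hi
    omega
  · exact .inl e11
  · rw [hreg 20 (by simp) (by simp), show s₂.reg 20 = s.reg 0 from hhigh 0, hN]
    simp
  · rw [e21]; push_cast; ring
  · intro r hr
    simp only [List.mem_cons, List.not_mem_nil, or_false, not_or] at hr
    rw [hreg r (by omega) (by omega)]
    exact hb2.1 r

theorem runs_minProgram {P Q : Program} {X W N b : ℕ} {s : State}
    {x : ℕ → Fin ℓ → ℕ} {v : ℕ → ℕ}
    (hX : Large G ℓ X) (hQ : CodeAt Q 0 (cliqueProgram ℓ P))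
    (hW : ∀ m ≤ (cliqueProgram ℓ P).length, (3 * X) ^ 2 ^ m ≤ W)
    (hb : b ≤ X) (hN : N ≤ G.n ^ ℓ)
    (h0 : ResultInv G ℓ N b x v X 0 s.reg s.mem) (hpc : s.pc = (resultProgram ℓ P).length) :
    ∃ (m : ℤ) (s' : State), m ≤ G.big (ℓ + 1) ∧ (∀ i < N, m ≤ resultCost G (x i) (v i)) ∧
      (m = G.big (ℓ + 1) ∨ ∃ i < N, m = resultCost G (x i) (v i)) ∧
      s'.reg 0 = (if m < G.big (ℓ + 1) then 1 else 0) ∧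
      s'.reg 1 = m - (pairs (ℓ + 1)).card * G.shift ∧ s'.pc = (cliqueProgram ℓ P).length ∧
      Runs Q W (2 + N * ((resultBody ℓ).length + 1) + (answerCode ℓ).length) s s' := by
  obtain ⟨hQ1, hc2⟩ := codeAt_append.1 (show CodeAt Q 0 (minProgram ℓ P ++ _) from hQ)
  obtain ⟨-, hc1⟩ := codeAt_append.1 (show CodeAt Q 0 (resultProgram ℓ P ++ _) from hQ1)
  rw [zero_add] at hc1 hc2
  have l1 : (minProgram ℓ P).length =
      (resultProgram ℓ P).length + ((resultBody ℓ).length + 2) := by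
    rw [minProgram, List.length_append, length_loopCode]
  have l2 : (cliqueProgram ℓ P).length = (minProgram ℓ P).length + (answerCode ℓ).length := by
    rw [cliqueProgram, List.length_append]
  have hX3 : Large G ℓ (3 * X) := hX.mono (by omega)
  obtain ⟨s1, i1, p1, r1⟩ := runs_loop (P := Q) (I := ResultInv G ℓ N b x v X) (N := N) hX3.two
    (hW _ (by omega)) hpc hc1 h0 (fun i s hi h => ⟨h.bounded hX hi hN hb, h.r20⟩)
    (fun i s hi h => resultBody_spec hX3 hi h)
  rw [length_loopCode, ← l1] at p1
  obtain ⟨hs, e0, e1⟩ := answerCode_spec hX3 i1.r5 i1.r6 i1.r7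
  obtain ⟨r2, p2⟩ := runs_straight (P := Q) hX3.two (hW _ (by omega)) (by rw [p1]; exact hc2)
    (i1.bounded hX le_rfl hN hb) hs
  exact ⟨s1.reg 11, _, i1.le_big, i1.le_cost, i1.eq_or, e0, e1, by rw [p2, p1, l2], r1.trans r2⟩

theorem cliqueProgram_spec [NeZero ℓ] {P : Program} {X W W' t : ℕ} {s : State} (hX : Large G ℓ X)
    (hWX : W ≤ X) (hW' : (3 * X) ^ 2 ^ (cliqueProgram ℓ P).length ≤ W')
    (hP : HaltsIn P W t (initState (G.starDB ℓ).input) s)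
    (hs : (starEvaluation ℓ).correct (G.starDB ℓ) s) :
    ∃ s', HaltsIn (cliqueProgram ℓ P) W'
      (2 * t + cliqueOverhead ℓ G.n) (initState G.input) s' ∧
      (minWeightClique (ℓ + 1)).correct G s' := by
  obtain ⟨L, b, hnd, hmem, hN, hb, hL⟩ := hs
  -- A list of `OUT` without repetitions has length `n ^ ℓ`; this bounds the number of passes of the
  -- third loop.
  have hlen : L.length = G.n ^ ℓ := by
    rw [← WGraph.outSize_starDB, StarDB.outSize, ← List.toFinset_card_of_nodup hnd,
      ← Set.ncard_coe_finset]
    congr 1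
    ext x
    simpa using hmem x
  have hlt : ∀ x ∈ L, ∀ i, x i < G.n := fun x hx => WGraph.mem_out_starDB.1 ((hmem x).1 hx)
  choose hx v hv hq using hL
  -- The list and its annotations are extended to all indices; the default values past the end are
  -- never used.
  set xs : ℕ → Fin ℓ → ℕ := fun j => L.getD j 0 with hxs
  set vs : ℕ → ℕ := fun j => if hj : j < L.length then v j hj else 0 with hvs
  have exs : ∀ j (hj : j < L.length), xs j = L[j] := fun j hj => by simp [hxs, hj]
  have evs : ∀ j (hj : j < L.length), vs j = v j hj := fun j hj => dif_pos hj
  -- The annotation minimises over `y` alone; the cost inside `x` does not depend on `y` and can be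
  -- added to the minimum.
  have hcost : ∀ j < L.length, (∀ y < G.n, resultCost G (xs j) (vs j) ≤ G.starCost (xs j) y) ∧
      ∃ y < G.n, resultCost G (xs j) (vs j) = G.starCost (xs j) y := by
    intro j hj
    obtain ⟨h1, y, hy, h2⟩ := WGraph.query_starDB_eq (hlt _ (List.getElem_mem hj)) (hq j hj)
    rw [exs j hj, evs j hj]
    exact ⟨fun y hy => by simpa [resultCost, WGraph.starCost] using h1 y hy,
      y, hy, by simpa [resultCost, WGraph.starCost] using h2⟩
  set Q := cliqueProgram ℓ P with hQ
  have hX2 := hX.two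
  have hpow : ∀ m ≤ Q.length, (3 * X) ^ 2 ^ m ≤ W' := fun m hm =>
    (Nat.pow_le_pow_right (by omega) (Nat.pow_le_pow_right two_pos hm)).trans hW'
  have hpow' : ∀ m ≤ Q.length, X ^ 2 ^ m ≤ W' := fun m hm =>
    (Nat.pow_le_pow_left (by omega) _).trans (hpow m hm)
  have hself := codeAt_self Q
  obtain ⟨hc3, -⟩ := codeAt_append.1 (show CodeAt Q 0 (minProgram ℓ P ++ _) from hself)
  obtain ⟨hc2, -⟩ := codeAt_append.1 (show CodeAt Q 0 (resultProgram ℓ P ++ _) from hc3)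
  obtain ⟨hc1, -⟩ := codeAt_append.1 (show CodeAt Q 0 (queryProgram ℓ P ++ _) from hc2)
  obtain ⟨hc0, -⟩ := codeAt_append.1 (show CodeAt Q 0 (dbProgram ℓ ++ _) from hc1)
  have l3 : Q.length = (minProgram ℓ P).length + _ := List.length_append
  have l2 : (minProgram ℓ P).length = (resultProgram ℓ P).length + _ := List.length_append
  have l1 : (resultProgram ℓ P).length = (queryProgram ℓ P).length + _ := List.length_append
  have l0 : (queryProgram ℓ P).length = (dbProgram ℓ).length + _ := List.length_append
  obtain ⟨s1, i1, p1, r1⟩ := runs_dbProgram hX hc0 fun m hm => hpow' m (by omega)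
  obtain ⟨hbX, s2, i2, p2, r2⟩ := runs_resultProgram (x := xs) (v := vs) hX hc2 hWX
    (by have := hX.head; have := hpow 0 (by omega); rw [pow_zero, pow_one] at this; omega)
    (fun m hm => hpow' m (by omega)) i1 p1 hP hN hb
    (fun j hj => by rw [exs j hj]; exact hlt _ (List.getElem_mem hj))
    (fun j hj i => by rw [exs j hj]; exact hx j hj i)
    (fun j hj => by rw [evs j hj]; exact hv j hj)
  obtain ⟨m, s3, hle, hmin, hor, e0, e1, p3, r3⟩ :=
    runs_minProgram hX hself hpow hbX hlen.le i2 p2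
  refine ⟨s3, ?_, ?_⟩
  · have := ((r1.trans r2).trans r3).haltsIn p3.ge
    rw [hlen] at this
    convert this using 1
    rw [cliqueOverhead]
    ring
  · have hall : ∀ x : Fin ℓ → ℕ, (∀ i, x i < G.n) → ∀ y < G.n, m ≤ G.starCost x y := by
      intro x hx y hy
      obtain ⟨j, hj, rfl⟩ := List.mem_iff_getElem.1 ((hmem x).2 (WGraph.mem_out_starDB.2 hx))
      rw [← exs j hj]
      exact (hmin j hj).trans ((hcost j hj).1 y hy)
    have hex : m = G.big (ℓ + 1) ∨
        ∃ x : Fin ℓ → ℕ, (∀ i, x i < G.n) ∧ ∃ y < G.n, m = G.starCost x y := by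
      refine hor.imp id fun ⟨j, hj, he⟩ => ?_
      obtain ⟨y, hy, hc⟩ := (hcost j hj).2
      exact ⟨xs j, by rw [exs j hj]; exact hlt _ (List.getElem_mem hj), y, hy, he.trans hc⟩
    rcases WGraph.isLeast_of_starCost hle hall hex with ⟨h1, h2⟩ | ⟨h1, h2⟩
    · refine .inr ⟨by rw [e0, if_pos h1], ?_⟩
      rw [e1]
      exact h2
    · exact .inl ⟨by rw [e0, if_neg (by omega)], h2⟩

end StarTropical

namespace StarTropical

/-! ## Polynomial bounds -/

/-- The function is bounded by a power of `n + 2`. -/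
def PolyBounded (f : ℕ → ℕ) : Prop := ∃ e, ∀ n, f n ≤ (n + 2) ^ e

namespace PolyBounded
variable {f g : ℕ → ℕ}

theorem const (c : ℕ) : PolyBounded fun _ => c :=
  ⟨c, fun n => Nat.lt_two_pow_self.le.trans (Nat.pow_le_pow_left (by omega) c)⟩

theorem id : PolyBounded fun n => n := ⟨1, fun n => by simp⟩

theorem add (hf : PolyBounded f) (hg : PolyBounded g) : PolyBounded fun n => f n + g n := by
  obtain ⟨a, ha⟩ := hf
  obtain ⟨b, hb⟩ := hg
  refine ⟨a + b + 1, fun n => ?_⟩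
  have h1 : (n + 2) ^ a ≤ (n + 2) ^ (a + b) := Nat.pow_le_pow_right (by omega) (by omega)
  have h2 : (n + 2) ^ b ≤ (n + 2) ^ (a + b) := Nat.pow_le_pow_right (by omega) (by omega)
  have := ha n
  have := hb n
  -- The extra factor `n + 2 ≥ 2` absorbs the two summands.
  have : (n + 2) ^ (a + b) * 2 ≤ (n + 2) ^ (a + b) * (n + 2) := Nat.mul_le_mul_left _ (by omega)
  rw [pow_succ]
  dsimp only
  omega

theorem mul (hf : PolyBounded f) (hg : PolyBounded g) : PolyBounded fun n => f n * g n := by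
  obtain ⟨a, ha⟩ := hf
  obtain ⟨b, hb⟩ := hg
  exact ⟨a + b, fun n => by rw [pow_add]; exact Nat.mul_le_mul (ha n) (hb n)⟩

theorem pow (hf : PolyBounded f) (m : ℕ) : PolyBounded fun n => f n ^ m := by
  obtain ⟨a, ha⟩ := hf
  exact ⟨a * m, fun n => by rw [pow_mul]; exact Nat.pow_le_pow_left (ha n) m⟩

end PolyBounded

/-- A bound for the shift of a graph with `n` nodes and weights of absolute value at most
`(n + 2) ^ d`. -/
def shiftBound (d n : ℕ) : ℕ := 2 * (n * n) * (n + 1 + (n + 2) ^ d) ^ 2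

/-- A bound for the shifted weights and the nodes. -/
def costBound (k d n : ℕ) : ℕ :=
  n + (2 * shiftBound d n + (2 * (pairs k).card * shiftBound d n + 1))

/-- A bound for all numbers that occur, where `(|D| + 2) ^ c` is the bound for the evaluation of the
query. -/
def numberBound (ℓ d c n : ℕ) : ℕ :=
  2 + ℓ + 2 * (pairs (ℓ + 1)).card + n + (2 * (n * n) + 1) + ℓ * (n * n) + costBound (ℓ + 1) d n +
    n ^ ℓ * (ℓ + 1) + (n + 1 + (n + 2) ^ d) + (ℓ * (n * n) + 2) ^ c

open PolyBounded in
theorem polyBounded_shiftBound (d : ℕ) : PolyBounded (shiftBound d) :=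
  ((const 2).mul (id.mul id)).mul (((id.add (const 1)).add ((id.add (const 2)).pow d)).pow 2)

open PolyBounded in
theorem polyBounded_costBound (k d : ℕ) : PolyBounded (costBound k d) :=
  id.add (((const 2).mul (polyBounded_shiftBound d)).add
    (((const _).mul (polyBounded_shiftBound d)).add (const 1)))

open PolyBounded in
theorem polyBounded_numberBound (ℓ d c : ℕ) : PolyBounded (numberBound ℓ d c) :=
  ((((((((((const 2).add (const ℓ)).add (const _)).add id).add
    (((const 2).mul (id.mul id)).add (const 1))).add ((const ℓ).mul (id.mul id))).add
    (polyBounded_costBound _ d)).add ((id.pow ℓ).mul (const _))).add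
    ((id.add (const 1)).add ((id.add (const 2)).pow d))).add
    ((((const ℓ).mul (id.mul id)).add (const 2)).pow c))

variable {G : WGraph} {ℓ d : ℕ}

theorem two_mul_shift_add_big_le (hG : (minWeightClique (ℓ + 1)).numbersLE G ((G.n + 2) ^ d)) :
    G.n + (2 * G.shift + G.big (ℓ + 1)) ≤ costBound (ℓ + 1) d G.n := by
  have h : G.shift ≤ shiftBound d G.n := WGraph.shift_le hG
  have := Nat.mul_le_mul_left (2 * (pairs (ℓ + 1)).card) h
  rw [costBound, WGraph.big]
  omega

theorem large_numberBound (c : ℕ)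
    (hG : (minWeightClique (ℓ + 1)).numbersLE G ((G.n + 2) ^ d)) :
    Large G ℓ (numberBound ℓ d c G.n) := by
  have h := two_mul_shift_add_big_le hG
  constructor
  case input =>
    intro a
    refine (WGraph.abs_input_le hG a).trans ?_
    rw [numberBound]
    exact_mod_cast (by omega)
  all_goals rw [numberBound]; omega

/-- The exponent `e` may be kept when the size changes from `n` to `|D|`: a fact exists only if `n >
0`, and then `n ≤ ℓ * n ^ 2 = |D|`. -/
theorem numbersLE_starDB [NeZero ℓ] (hℓ : 2 ≤ ℓ) {e : ℕ}
    (he : ∀ n, costBound (ℓ + 1) d n ≤ (n + 2) ^ e)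
    (hG : (minWeightClique (ℓ + 1)).numbersLE G ((G.n + 2) ^ d)) :
    (starEvaluation ℓ).numbersLE (G.starDB ℓ) (((G.starDB ℓ).size + 2) ^ e) := by
  rintro ⟨⟨i, x, y⟩, a⟩ hf
  obtain ⟨hx, hy, rfl⟩ := WGraph.mem_facts_starDB.1 hf
  have h1 := (two_mul_shift_add_big_le hG).trans (he G.n)
  have h2 : G.n + 2 ≤ (G.starDB ℓ).size + 2 := by
    rw [WGraph.size_starDB]
    have : 0 < G.n := by omega
    nlinarith [Nat.mul_le_mul_left G.n this, Nat.mul_le_mul_right (G.n * G.n) hℓ]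
  have h3 := h1.trans (Nat.pow_le_pow_left h2 e)
  have := WGraph.cost_le (k := ℓ + 1) (WGraph.pos_lt hx hy)
  dsimp only
  refine ⟨?_, ?_, ?_⟩ <;> omega

/-! ## Running times -/

theorem cliqueOverhead_le (ℓ : ℕ) : ∃ K : ℕ, ∀ n, cliqueOverhead ℓ n ≤ K * (n * n + n ^ ℓ + 1) := by
  refine ⟨(initCode.length + 2 + (bigCode ℓ).length + 2 + 1 + resultCode.length + 2 +
    (answerCode ℓ).length) + (2 * (shiftBody.length + 1) + ℓ * (tupleBody.length + 1)) +
    ((resultBody ℓ).length + 1), fun n => ?_⟩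
  have key : ∀ a b c m k : ℕ, a + b * m + c * k ≤ (a + b + c) * (m + k + 1) := by
    intro a b c m k
    have : (a + b + c) * (m + k + 1) = a + b * m + c * k +
      (a * m + a * k + b * k + b + c * m + c) := by ring
    omega
  refine le_trans (le_of_eq ?_) (key _ _ _ (n * n) (n ^ ℓ))
  rw [cliqueOverhead]
  ring

/-- The exponent on the right is at least `ℓ ≥ 2` because the saving is capped at `1`. For the
query, `2 + ℓ * (1 - 1/ℓ - ε) = ℓ + 1 - ℓ * ε`. -/
theorem star_time_le (hℓ : 2 ≤ ℓ) {ε : ℝ} (n : ℕ) :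
    (n * n : ℝ) ≤ (n : ℝ) ^ (((ℓ + 1 : ℕ) : ℝ) - min 1 (ℓ * ε)) ∧
    (n ^ ℓ : ℝ) ≤ (n : ℝ) ^ (((ℓ + 1 : ℕ) : ℝ) - min 1 (ℓ * ε)) ∧
    (n * n : ℝ) * ((n ^ ℓ : ℕ) : ℝ) ^ (1 - 1 / (ℓ : ℝ) - ε) ≤
      (n : ℝ) ^ (((ℓ + 1 : ℕ) : ℝ) - min 1 (ℓ * ε)) := by
  have hℓ' : (2 : ℝ) ≤ ℓ := by exact_mod_cast hℓ
  have hmin := min_le_left 1 (ℓ * ε)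
  have hmin' := min_le_right 1 (ℓ * ε)
  -- Real powers are monotone in the exponent only for bases at least `1`; for `n = 0` all left
  -- sides vanish.
  rcases Nat.eq_zero_or_pos n with rfl | hn
  · have : (0 : ℝ) ≤ (0 : ℝ) ^ (((ℓ + 1 : ℕ) : ℝ) - min 1 (ℓ * ε)) :=
      Real.rpow_nonneg le_rfl _
    simpa [show ℓ ≠ 0 by omega] using this
  · have h1 : (1 : ℝ) ≤ n := by exact_mod_cast hn
    have h0 : (0 : ℝ) < n := by linarith
    have e2 : (n * n : ℝ) = (n : ℝ) ^ (2 : ℝ) := by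
      rw [← sq, ← Real.rpow_natCast]; norm_num
    refine ⟨?_, ?_, ?_⟩
    · rw [e2]
      refine Real.rpow_le_rpow_of_exponent_le h1 ?_
      push_cast
      linarith
    · rw [← Real.rpow_natCast]
      refine Real.rpow_le_rpow_of_exponent_le h1 ?_
      push_cast
      linarith
    · rw [e2, Nat.cast_pow, ← Real.rpow_natCast, ← Real.rpow_mul h0.le, ← Real.rpow_add h0]
      refine Real.rpow_le_rpow_of_exponent_le h1 ?_
      have : (ℓ : ℝ) * (1 - 1 / ℓ - ε) = ℓ - 1 - ℓ * ε := by field_simp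
      rw [this]
      push_cast
      linarith

theorem Problem.SolvableInTime.mono {p : Problem} {T T' : p.Inst → ℝ} (h : p.SolvableInTime T)
    (hT : ∀ I, T I ≤ T' I) : p.SolvableInTime T' := by
  obtain ⟨P, hP⟩ := h
  refine ⟨P, fun d => ?_⟩
  obtain ⟨c, C, h⟩ := hP d
  refine ⟨c, C, fun I hI => ?_⟩
  obtain ⟨t, s, h1, h2, h3⟩ := h I hI
  exact ⟨t, s, h1, h2, h3.trans (by gcongr; exact hT I)⟩

/-- The clique program depends only on `ℓ` and `P`. The bounds follow in order: `d` determines `e`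
for the annotations, `P` and `e` give `c` and `C`, and these give the word bound `c'`. -/
theorem minWeightClique_solvable (hℓ : 2 ≤ ℓ) {ε : ℝ}
    (h : (starEvaluation ℓ).SolvableInTime (fun D : StarDB ℓ =>
      (D.size : ℝ) + (D.outSize : ℝ) +
        (D.size : ℝ) * (D.outSize : ℝ) ^ (1 - 1 / (ℓ : ℝ) - ε))) :
    (minWeightClique (ℓ + 1)).SolvableInTime
      (fun G : WGraph => (G.n : ℝ) ^ (((ℓ + 1 : ℕ) : ℝ) - min 1 (ℓ * ε))) := by
  have : NeZero ℓ := ⟨by omega⟩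
  obtain ⟨P, hP⟩ := h
  refine ⟨cliqueProgram ℓ P, fun d => ?_⟩
  obtain ⟨e, he⟩ := polyBounded_costBound (ℓ + 1) d
  obtain ⟨c, C, hC⟩ := hP e
  obtain ⟨c', hc'⟩ := ((PolyBounded.const 3).mul (polyBounded_numberBound ℓ d c)).pow
    (2 ^ (cliqueProgram ℓ P).length)
  obtain ⟨K, hK⟩ := cliqueOverhead_le ℓ
  -- Relocation doubles the time of `P`. With `R` the target bound, the three terms of that time are
  -- at most `ℓ * R`, `R` and `ℓ * R`, and the overhead is at most `K * (2 * R + 1)`.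
  refine ⟨c', 2 * C * (2 * ℓ + 1) + 2 * K, fun (G : WGraph) hG => ?_⟩
  obtain ⟨t, s, hrun, hcorrect, ht⟩ := hC (G.starDB ℓ) (numbersLE_starDB hℓ he hG)
  obtain ⟨s', hrun', hcorrect'⟩ := cliqueProgram_spec (large_numberBound c hG)
    (by
      rw [show (starEvaluation ℓ).size (G.starDB ℓ) = _ from WGraph.size_starDB, numberBound]
      omega) (hc' G.n) hrun hcorrect
  refine ⟨_, s', hrun', hcorrect', ?_⟩
  obtain ⟨h1, h2, h3⟩ := star_time_le hℓ (ε := ε) G.n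
  have hK' : (cliqueOverhead ℓ G.n : ℝ) ≤ K * (G.n * G.n + G.n ^ ℓ + 1) := by
    exact_mod_cast hK G.n
  simp only [WGraph.size_starDB, WGraph.outSize_starDB] at ht
  rw [Nat.cast_mul, Nat.cast_mul, mul_assoc, mul_assoc, Nat.cast_pow] at ht
  rw [Nat.cast_pow] at h3
  dsimp only
  set R := (G.n : ℝ) ^ (((ℓ + 1 : ℕ) : ℝ) - min 1 (ℓ * ε))
  have hR : 0 ≤ R := Real.rpow_nonneg (Nat.cast_nonneg _) _
  have hT : (t : ℝ) ≤ C * ((2 * ℓ + 1) * (R + 1)) := by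
    refine ht.trans ?_
    gcongr
    nlinarith [mul_le_mul_of_nonneg_left h1 (Nat.cast_nonneg (α := ℝ) ℓ),
      mul_le_mul_of_nonneg_left h3 (Nat.cast_nonneg (α := ℝ) ℓ), Nat.cast_nonneg (α := ℝ) ℓ]
  have hO : (cliqueOverhead ℓ G.n : ℝ) ≤ K * (2 * (R + 1)) := by
    refine hK'.trans ?_
    gcongr
    linarith
  push_cast
  linarith

end StarTropical

/-! ### The two lower bounds. -/

theorem mainTheorem9 (hconj : StarTropical.MinWeightCliqueConjecture)
    (ℓ : ℕ) (hℓ : 2 ≤ ℓ) (ε : ℝ) (hε : 0 < ε) :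
    (¬ (StarTropical.starEvaluation ℓ).SolvableInTime
      (fun D : StarTropical.StarDB ℓ =>
        (D.size : ℝ) * (D.outSize : ℝ) ^ (1 - 1 / (ℓ : ℝ) - ε))) ∧
    (¬ (StarTropical.starEvaluation ℓ).SolvableInTime
      (fun D : StarTropical.StarDB ℓ =>
        (D.size : ℝ) + (D.outSize : ℝ) +
          (D.size : ℝ) * (D.outSize : ℝ) ^ (1 - 1 / (ℓ : ℝ) - ε))) := by
  have main : ¬ (StarTropical.starEvaluation ℓ).SolvableInTime
      (fun D : StarTropical.StarDB ℓ =>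
        (D.size : ℝ) + (D.outSize : ℝ) +
          (D.size : ℝ) * (D.outSize : ℝ) ^ (1 - 1 / (ℓ : ℝ) - ε)) := by
    intro h
    have hpos : 0 < min 1 (ℓ * ε) :=
      lt_min one_pos (mul_pos (by exact_mod_cast (by omega : 0 < ℓ)) hε)
    exact hconj (ℓ + 1) (by omega) ⟨_, hpos, StarTropical.minWeightClique_solvable hℓ h⟩
  -- The first time bound is the smaller one, so an algorithm meeting it also meets the second.
  refine ⟨fun h => main (h.mono fun D => ?_), main⟩
  exact le_add_of_nonneg_left (by positivity)
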